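/- Conventions. An $n$-dimensional topological stratification $\mathfrak X$ of a paracompact Hausdorff space $X$ is a filtration by closed subsets $X=X^n\supseteq X^{n-1}\supseteq\cdots\supseteq X^0\supseteq X^{-1}=\emptyset$ such that each $x\in X^{n-k}-X^{n-k-1}$ has a neighborhood $N$ with a homeomorphism $\mathbb R^{n-k}\times cL\cong N$, where $L$ is a compact Hausdorff space with a $(k-1)$-dimensional topological stratification ($L=\emptyset$ if $k=0$), $cL$ is the open cone on $L$ ($c\emptyset$ is a point), and the homeomorphism carries $\mathbb R^{n-k}\times cL^j$ onto $N\cap X^{n-k+j+1}$ for all $j\ge 0$ and $\mathbb R^{n-k}\times\{\text{cone point}\}$ onto $N\cap X^{n-k}$; for $n=0$, $X$ is moreover required to be countable. $X$ is an $n$-dimensional stratified topological pseudomanifold with (possibly empty) pseudoboundary if in addition $X-X^{n-1}$ is dense. Put $\Sigma=X^{n-1}$, $U_k=X-X^{n-k}$ (so $U_1=X-\Sigma$, $U_{n+1}=X$), and let $i_k:U_k\hookrightarrow U_{k+1}$ be the inclusion. A perversity is a function $\bar p:\mathbb Z^{\ge 1}\to\mathbb Z$ with $\bar p(k)\le\bar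 p(k+1)\le\bar p(k)+1$. Let $R$ be a commutative ring and let $\mathcal G$ be a locally constant sheaf of $R$-modules on $X-\Sigma$. The Deligne sheaf is $\mathcal P^*=\mathcal P^*_{n+1}$, an object of the derived category of sheaves of $R$-modules on $X$, where $\mathcal P^*_1=\mathcal G[0]$ and $\mathcal P^*_{k+1}=\tau_{\le\bar p(k)}Ri_{k*}\mathcal P^*_k$; and $I^{\bar p}_{\mathfrak X}H^j(X;\mathcal G)=\mathbb H^j(X;\mathcal P^*)$. Proposition 3.1. Let $X$ be an $n$-dimensional stratified topological pseudomanifold with possibly empty pseudoboundary, with stratification $\mathfrak X$, and let $\bar p$, $R$, $\mathcal G$ be as above. Let $m\ge 0$ be an integer such that $\bar p(k)\ge k-1$ for all $k$ with $1\le k\le m$. Then: 1. for every integer $j\le m-1$ there is an isomorphism of $R$-modules $I^{\bar p}_{\mathfrak X}H^j(X;\mathcal G)\cong H^j(X-\Sigma;\mathcal G)$; 2. if $m\le n$, then $\mathcal P^*_{m+1}\cong Ri_*\mathcal G$ in the derived category of sheaves of $R$-modules on $U_{m+1}$, where $i:X-\Sigma\hookrightarrow U_{m+1}$ is the inclusion;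 3. there is a morphism $\mathcal P^*\to Ri_*\mathcal G$ in the derived category of sheaves of $R$-modules on $X$, where $i:X-\Sigma\hookrightarrow X$ is the inclusion, which induces isomorphisms on cohomology sheaves $\mathcal H^j$ for all $j\le m-1$. -/

import Mathlib

universe u

open CategoryTheory TopologicalSpace Opposite

noncomputable section

/-! ### Open cones -/

/-- The relation on `{vertex} ⊔ L × [0,1)` which identifies every `(y, 0)` with the vertex. -/
inductive OpenCone.Rel (L : Type u) :
    Unit ⊕ L × Set.Ico (0 : ℝ) 1 → Unit ⊕ L × Set.Ico (0 : ℝ) 1 → Prop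
  | vertex (y : L) : OpenCone.Rel L (Sum.inr (y, ⟨0, by simp⟩)) (Sum.inl ())

/-- The open cone `cL = L × [0,1) / (y,0) ∼ (z,0)`. The vertex is adjoined explicitly, so that the
cone on the empty space is a point, as usual; for `L` nonempty this changes nothing. -/
def OpenCone (L : Type u) : Type u := Quot (OpenCone.Rel L)

namespace OpenCone

variable {L : Type u}

/-- The quotient topology. -/
instance instTopologicalSpace [TopologicalSpace L] : TopologicalSpace (OpenCone L) :=
  inferInstanceAs (TopologicalSpace (Quot _))

/-- The cone point. -/
def vertex : OpenCone L := Quot.mk _ (Sum.inl ())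

/-- The class of `(y, t)`. -/
def mk (y : L) (t : Set.Ico (0 : ℝ) 1) : OpenCone L := Quot.mk _ (Sum.inr (y, t))

/-- The cone `cA ⊆ cL` on a subset `A ⊆ L`; `c∅` consists of the cone point. -/
def subcone (A : Set L) : Set (OpenCone L) := {vertex} ∪ {z | ∃ y ∈ A, ∃ t, z = mk y t}

end OpenCone

/-! ### Stratifications

A filtration `X = Xⁿ ⊇ Xⁿ⁻¹ ⊇ ⋯ ⊇ X⁰ ⊇ X⁻¹ = ∅` is recorded as a map `F : ℤ → Set X` with
`F i = ∅` for `i < 0` and `F i = X` for `i ≥ n`. -/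

/-- `φ` is the homeomorphism of `ℝᵃ × cL` onto a distinguished (open) neighbourhood in `X`, where
`L` is filtered by `G` and `X` by `F`: it maps `ℝᵃ × cLʲ` onto the part of the neighbourhood in
`X^{a+j+1}`, for all `j ≥ -1` (for `j = -1`, it maps `ℝᵃ × {vertex}` onto the part in `Xᵃ`). -/
def IsDistinguishedChart {X L : Type u} [TopologicalSpace X] [TopologicalSpace L]
    (F : ℤ → Set X) (G : ℤ → Set L) (a : ℕ) (φ : EuclideanSpace ℝ (Fin a) × OpenCone L → X) :
    Prop :=
  Topology.IsOpenEmbedding φ ∧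
    ∀ j : ℤ, -1 ≤ j → φ '' {z | z.2 ∈ OpenCone.subcone (G j)} = Set.range φ ∩ F (a + j + 1)

/-- `F` is an `n`-dimensional topological stratification of the space `X`. The link of a point of
`X^{n-k} - X^{n-k-1}` is a compact Hausdorff space with a `(k-1)`-dimensional topological
stratification, which for `k = 0` means that it is empty. -/
def IsTopologicalStratification (n : ℕ) (X : Type u) [TopologicalSpace X] (F : ℤ → Set X) : Prop :=
  T2Space X ∧ ParacompactSpace X ∧ (n = 0 → Countable X) ∧
  Monotone F ∧ (∀ i, IsClosed (F i)) ∧ (∀ i, i < 0 → F i = ∅) ∧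
  (∀ i, (n : ℤ) ≤ i → F i = Set.univ) ∧
  ∀ (k : ℕ) (hk : k ≤ n) (x : X), x ∈ F ((n : ℤ) - k) → x ∉ F ((n : ℤ) - k - 1) →
    ∃ (L : Type u) (_ : TopologicalSpace L) (G : ℤ → Set L),
      CompactSpace L ∧ T2Space L ∧
      (match k, hk with
        | 0, _ => IsEmpty L
        | k' + 1, _ => IsTopologicalStratification k' L G) ∧
      ∃ φ : EuclideanSpace ℝ (Fin (n - k)) × OpenCone L → X,
        IsDistinguishedChart F G (n - k) φ ∧ x ∈ Set.range φ
termination_by n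

/-- An `n`-dimensional stratified topological pseudomanifold, with possibly empty pseudoboundary:
codimension one strata are allowed. -/
structure StratifiedPseudomanifold (n : ℕ) (X : TopCat.{u}) where
  /-- the skeleta `Xⁱ` -/
  skeleton : ℤ → Set X
  isTopologicalStratification : IsTopologicalStratification n X skeleton
  dense_top : Dense (skeleton ((n : ℤ) - 1))ᶜ

/-- A perversity `p : ℤ^{≥ 1} → ℤ`; the value at `0` is irrelevant. -/
structure Perversity where
  toFun : ℕ → ℤ
  le_succ : ∀ k, 1 ≤ k → toFun k ≤ toFun (k + 1)
  succ_le : ∀ k, 1 ≤ k → toFun (k + 1) ≤ toFun k + 1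

instance : CoeFun Perversity (fun _ => ℕ → ℤ) := ⟨Perversity.toFun⟩

/-! ### Sheaves of modules and derived functors -/

section Sheaves

variable (R : Type u) [CommRing R]

/-- Sheaves of `R`-modules on `X`. -/
abbrev ModSheaf (X : TopCat.{u}) := TopCat.Sheaf (ModuleCat.{u} R) X

instance instHasDerivedCategoryModSheaf (X : TopCat.{u}) : HasDerivedCategory (ModSheaf R X) :=
  HasDerivedCategory.standard _

instance instHasDerivedCategoryModuleCat : HasDerivedCategory (ModuleCat.{u} R) :=
  HasDerivedCategory.standard _

/-- The bounded below derived category of sheaves of `R`-modules on `X`. -/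
abbrev DPlus (X : TopCat.{u}) := DerivedCategory.Plus (ModSheaf R X)

instance instAdditivePushforward {X Y : TopCat.{u}} (f : X ⟶ Y) :
    (TopCat.Sheaf.pushforward (ModuleCat.{u} R) f).Additive where
  map_add := by intros; rfl

/-- The right derived pushforward `Rf_*`. -/
abbrev derivedPushforward {X Y : TopCat.{u}} (f : X ⟶ Y) : DPlus R X ⥤ DPlus R Y :=
  (TopCat.Sheaf.pushforward (ModuleCat.{u} R) f).rightDerivedFunctorPlus

/-- The functor of global sections. -/
abbrev globalSections (X : TopCat.{u}) : ModSheaf R X ⥤ ModuleCat.{u} R :=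
  (sheafSections (Opens.grothendieckTopology X) (ModuleCat.{u} R)).obj (op ⊤)

instance instAdditiveGlobalSections (X : TopCat.{u}) : (globalSections R X).Additive where
  map_add := by intros; rfl

variable {R}

/-- The hypercohomology module `ℍʲ(X; K)`. -/
def hypercohomology {X : TopCat.{u}} (K : DPlus R X) (j : ℤ) : ModuleCat.{u} R :=
  (DerivedCategory.Plus.homologyFunctor (ModuleCat.{u} R) j).obj
    ((globalSections R X).rightDerivedFunctorPlus.obj K)

/-- A sheaf as a complex concentrated in degree `0`. -/
abbrev sheafInDegreeZero {X : TopCat.{u}} (G : ModSheaf R X) : DPlus R X :=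
  (DerivedCategory.Plus.singleFunctor (ModSheaf R X) 0).obj G

/-- The sheaf cohomology module `Hʲ(X; G) = Rʲ Γ(X; G)`. -/
def sheafCohomology {X : TopCat.{u}} (G : ModSheaf R X) (j : ℤ) : ModuleCat.{u} R :=
  hypercohomology (sheafInDegreeZero G) j

/-- Local coefficient systems: every point has an open neighbourhood on which the sheaf is
isomorphic to a constant sheaf. -/
def IsLocalSystem {X : TopCat.{u}} (G : ModSheaf R X) : Prop :=
  ∀ x : X, ∃ V : Opens X, x ∈ V ∧
    Sheaf.IsConstant (Opens.grothendieckTopology V) (V.sheafRestrict.obj G)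

end Sheaves

/-! ### The Deligne sheaf and intersection cohomology -/

namespace StratifiedPseudomanifold

variable {n : ℕ} {X : TopCat.{u}} (S : StratifiedPseudomanifold n X)

/-- The open set `U_k = X - X^{n-k}`; so `U_1 = X - Σ` and `U_{n+1} = X`. -/
def opens (k : ℕ) : Opens X where
  carrier := (S.skeleton ((n : ℤ) - k))ᶜ
  is_open' := by
    have h := S.isTopologicalStratification
    rw [IsTopologicalStratification] at h
    exact (h.2.2.2.2.1 _).isOpen_compl

/-- `U_k` as a space. -/
abbrev U (k : ℕ) : TopCat.{u} := (Opens.toTopCat X).obj (S.opens k)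

lemma opens_mono {k l : ℕ} (h : k ≤ l) : S.opens k ≤ S.opens l := by
  have hS := S.isTopologicalStratification
  rw [IsTopologicalStratification] at hS
  exact Set.compl_subset_compl.mpr (hS.2.2.2.1 (by lia))

/-- The inclusion `U_k ↪ U_l` for `k ≤ l`. -/
abbrev incl {k l : ℕ} (h : k ≤ l) : S.U k ⟶ S.U l :=
  (Opens.toTopCat X).map (homOfLE (S.opens_mono h))

/-- The inclusion `U_k ↪ X`; for `k = n + 1` this is the identification `U_{n+1} = X`. -/
abbrev inclX (k : ℕ) : S.U k ⟶ X := (S.opens k).inclusion'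

variable {R : Type u} [CommRing R]

/-- `S.deligne p G k` is the complex `P_{k+1}` on `U_{k+1}`:
`P_1 = G` and `P_{k+1} = τ_{≤ p(k)} R(i_k)_* P_k`, where `i_k : U_k ↪ U_{k+1}`. -/
def deligne (p : Perversity) (G : ModSheaf R (S.U 1)) : (k : ℕ) → DPlus R (S.U (k + 1))
  | 0 => sheafInDegreeZero G
  | k + 1 => (DerivedCategory.Plus.TStructure.t.truncLE (p (k + 1))).obj
      ((derivedPushforward R (S.incl (Nat.le_succ (k + 1)))).obj (deligne p G k))

/-- The Deligne sheaf `P = P_{n+1}`, on `X = U_{n+1}`. -/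
def deligneSheaf (p : Perversity) (G : ModSheaf R (S.U 1)) : DPlus R X :=
  (derivedPushforward R (S.inclX (n + 1))).obj (S.deligne p G n)

/-- The intersection cohomology module `I^p Hʲ(X; G) = ℍʲ(X; P)`. -/
def intersectionCohomology (p : Perversity) (G : ModSheaf R (S.U 1)) (j : ℤ) : ModuleCat.{u} R :=
  hypercohomology (S.deligneSheaf p G) j

end StratifiedPseudomanifold

end

universe v w


/-! The heart of the matter is that the cohomology sheaves of Ri_*G on U_{k+1} vanish in degrees ≥
k, for k ≥ 1. A point of codimension l, 1 ≤ l ≤ k, has arbitrarily small neighbourhoods whose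
regular part is (L - Σ_L) × ℝᵃ × ℝ, with L the link. Here L - Σ_L is a σ-compact manifold of
dimension l - 1, so a local system on the product has no cohomology in degrees ≥ l
(`exact_pushforward`, `isLE_derivedPushforward`).

Hence truncation at p(k) ≥ k - 1 changes nothing, and P_{k+1} = Ri_*G for k ≤ m by induction
(`nonempty_deligne_iso`). Later truncations, at p(k) ≥ p(m) ≥ m - 1, only affect degrees ≥ m; for m
= 0 it suffices that everything lives in degrees ≥ 0. So the comparison map P → Ri_*G has cone in
degrees ≥ m (`exists_deligne_hom`). This property, `HasConeGE`, is stable under composition and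
under right derived functors, hence under further direct images and RΓ, and it gives isomorphisms on
cohomology in degrees < m.

Vanishing on manifolds is proved with sections of an injective resolution. Exactness near compact
sets is glued by Mayer–Vietoris. The bound on the degree comes from inductive dimension: points have
small cubes as neighbourhoods, whose boundaries have smaller dimension (`DimLT.succ`,
`DimLT.of_subset_image`). An exhaustion passes to the whole manifold, which is why
`sigmaCompactSpace` is needed. The euclidean factor is absorbed by regarding a complex on M × B as
one on M (`fiberComplex`); its local exactness is the Poincaré lemma
`IsLocallyConstant.exactNear_univ`, proved by subdividing boxes. -/

/-! ### Flasque complexes through global sections, and Mayer–Vietoris gluing -/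

/-- A complex of flasque sheaves on a space, described by its global sections and their supports. -/
structure SupportedComplex (M : Type u) [TopologicalSpace M] where
  /-- the global sections in degree `j` -/
  sec : ℤ → Type v
  [addCommGroup : ∀ j, AddCommGroup (sec j)]
  /-- the differential -/
  d : ∀ i j, sec i →+ sec j
  d_d : ∀ i j k s, d j k (d i j s) = 0
  /-- the support of a section -/
  supp : ∀ {j}, sec j → Set M
  isClosed_supp : ∀ {j} (s : sec j), IsClosed (supp s)
  supp_zero : ∀ j, supp (0 : sec j) = ∅
  supp_sub : ∀ {j} (s t : sec j), supp (s - t) ⊆ supp s ∪ supp t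
  supp_d : ∀ i j (s : sec i), supp (d i j s) ⊆ supp s
  -- Flasqueness is built in here: local data are represented by global sections, and the glued
  -- section is again global.
  glue : ∀ {j} {ι : Type} (U : ι → Set M) (_ : ∀ a, IsOpen (U a)) (s : ι → sec j),
    (∀ a b, Disjoint (supp (s a - s b)) (U a ∩ U b)) →
      ∃ t : sec j, ∀ a, Disjoint (supp (t - s a)) (U a)

namespace SupportedComplex

attribute [instance] SupportedComplex.addCommGroup

variable {M : Type u} [TopologicalSpace M] (C : SupportedComplex.{u, v} M)

/-- Two sections agree in a neighbourhood of `K`. -/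
def Agree {j : ℤ} (K : Set M) (s t : C.sec j) : Prop := Disjoint (C.supp (s - t)) K

/-- Every section which is closed near `K` is exact near `K`. -/
def ExactNear (i j k : ℤ) (K : Set M) : Prop :=
  ∀ s : C.sec j, C.Agree K (C.d j k s) 0 → ∃ t : C.sec i, C.Agree K (C.d i j t) s

/-- Every section which is closed near `K` can be replaced, without changing it near `K`, by a
section which is closed near `K'`. -/
def ExtendsTo (i j : ℤ) (K K' : Set M) : Prop :=
  ∀ z : C.sec i, C.Agree K (C.d i j z) 0 →
    ∃ z' : C.sec i, C.Agree K' (C.d i j z') 0 ∧ C.Agree K z' z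

variable {C}

lemma supp_neg {j : ℤ} (s : C.sec j) : C.supp (-s) ⊆ C.supp s := by
  have h := C.supp_sub 0 s
  rwa [C.supp_zero, Set.empty_union, zero_sub] at h

lemma supp_add {j : ℤ} (s t : C.sec j) : C.supp (s + t) ⊆ C.supp s ∪ C.supp t := by
  have h := C.supp_sub s (-t)
  rw [sub_neg_eq_add] at h
  exact h.trans (Set.union_subset_union_right _ (supp_neg t))

section Agree

variable {i j k : ℤ} {K K' : Set M} {s t r s' t' : C.sec j}

lemma Agree.refl (K : Set M) (s : C.sec j) : C.Agree K s s := by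
  simp [Agree, C.supp_zero]

lemma Agree.symm (h : C.Agree K s t) : C.Agree K t s :=
  Disjoint.mono_left (by simpa using supp_neg (s - t)) h

lemma Agree.trans (h : C.Agree K s t) (h' : C.Agree K t r) : C.Agree K s r :=
  Disjoint.mono_left (by simpa using supp_add (s - t) (t - r)) (Set.disjoint_union_left.2 ⟨h, h'⟩)

lemma Agree.mono (h : C.Agree K s t) (hK : K' ⊆ K) : C.Agree K' s t :=
  Disjoint.mono_right hK h

lemma Agree.union (h : C.Agree K s t) (h' : C.Agree K' s t) : C.Agree (K ∪ K') s t :=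
  Set.disjoint_union_right.2 ⟨h, h'⟩

lemma Agree.sub (h : C.Agree K s t) (h' : C.Agree K s' t') : C.Agree K (s - s') (t - t') :=
  Disjoint.mono_left (by
    have := C.supp_sub (s - t) (s' - t')
    rwa [sub_sub_sub_comm] at this) (Set.disjoint_union_left.2 ⟨h, h'⟩)

lemma Agree.d (h : C.Agree K s t) (k : ℤ) : C.Agree K (C.d j k s) (C.d j k t) :=
  Disjoint.mono_left (by rw [← map_sub]; exact C.supp_d _ _ _) h

lemma Agree.of_empty : C.Agree ∅ s t := Set.disjoint_empty _

/-- Agreement near a set is agreement on an open neighbourhood. -/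
lemma Agree.exists_open (h : C.Agree K s t) : ∃ U, IsOpen U ∧ K ⊆ U ∧ C.Agree U s t :=
  ⟨(C.supp (s - t))ᶜ, (C.isClosed_supp _).isOpen_compl, Set.subset_compl_iff_disjoint_left.2 h,
    disjoint_compl_right⟩

lemma Agree.of_iUnion {ι : Type*} {K : ι → Set M} (h : ∀ a, C.Agree (K a) s t) :
    C.Agree (⋃ a, K a) s t := Set.disjoint_iUnion_right.2 h

/-- Sections which agree near the intersection of two compact sets can be glued. -/
lemma exists_agree_of_agree_inter [T2Space M] {K₁ K₂ : Set M} (h₁ : IsCompact K₁)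
    (h₂ : IsCompact K₂) (h : C.Agree (K₁ ∩ K₂) s t) :
    ∃ r : C.sec j, C.Agree K₁ r s ∧ C.Agree K₂ r t := by
  -- K₁ ∩ P and K₂ ∩ P are disjoint compact sets, hence separated by O₁ and O₂. Then s on O₁ ∪ Pᶜ
  -- and t on O₂ ∪ Pᶜ overlap only inside Pᶜ, where they agree.
  set P := C.supp (s - t) with hP
  have hPc : IsClosed P := C.isClosed_supp _
  obtain ⟨O₁, O₂, hO₁, hO₂, hK₁, hK₂, hO⟩ :=
    SeparatedNhds.of_isCompact_isCompact (h₁.inter_right hPc) (h₂.inter_right hPc)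
      (by
        rw [Set.disjoint_left]
        rintro x ⟨hx₁, hxP⟩ ⟨hx₂, -⟩
        exact Set.disjoint_left.1 h hxP ⟨hx₁, hx₂⟩)
  have key : ∀ {K O : Set M}, K ∩ P ⊆ O → K ⊆ O ∪ Pᶜ := fun hK x hx ↦ by
    by_cases hxP : x ∈ P
    · exact Or.inl (hK ⟨hx, hxP⟩)
    · exact Or.inr hxP
  have hst : C.Agree ((O₁ ∪ Pᶜ) ∩ (O₂ ∪ Pᶜ)) s t := by
    refine Set.disjoint_left.2 ?_
    rintro x hx ⟨h1 | h1, h2 | h2⟩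
    exacts [Set.disjoint_left.1 hO h1 h2, h2 hx, h1 hx, h1 hx]
  obtain ⟨r, hr⟩ := C.glue (ι := Bool) (fun a ↦ bif a then O₁ ∪ Pᶜ else O₂ ∪ Pᶜ)
    (by rintro (_ | _); exacts [hO₂.union hPc.isOpen_compl, hO₁.union hPc.isOpen_compl])
    (fun a ↦ bif a then s else t)
    (by
      rintro (_ | _) (_ | _)
      exacts [Agree.refl _ _, (hst.mono (by rw [Set.inter_comm]; rfl)).symm, hst, Agree.refl _ _])
  exact ⟨r, Agree.mono (hr true) (key hK₁), Agree.mono (hr false) (key hK₂)⟩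

end Agree

section Exact

variable {h i j k : ℤ} {K K' K₁ K₂ : Set M}

/-- A primitive is a global section, so its differential is closed everywhere and serves as the
extension. -/
lemma ExactNear.extendsTo (hK : C.ExactNear h i j K) (K' : Set M) : C.ExtendsTo i j K K' :=
  fun z hz ↦ by
    obtain ⟨r, hr⟩ := hK z hz
    exact ⟨C.d h i r, by rw [C.d_d]; exact Agree.refl _ _, hr⟩

lemma exactNear_empty : C.ExactNear i j k ∅ := fun _ _ ↦ ⟨0, Agree.of_empty⟩

/-- Gluing primitives of a section. -/
lemma exists_primitive_union [T2Space M] (h₁ : IsCompact K₁) (h₂ : IsCompact K₂)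
    (hS : C.ExtendsTo i j (K₁ ∩ K₂) K₁) {s : C.sec j}
    (hs₁ : ∃ t, C.Agree K₁ (C.d i j t) s) (hs₂ : ∃ t, C.Agree K₂ (C.d i j t) s) :
    ∃ t, C.Agree (K₁ ∪ K₂) (C.d i j t) s := by
  obtain ⟨t₁, ht₁⟩ := hs₁
  obtain ⟨t₂, ht₂⟩ := hs₂
  -- Two primitives differ by a closed section near the overlap. Once this is extended over K₁ it
  -- can be subtracted from t₁, which then matches t₂ on the overlap.
  obtain ⟨z, hz, hzt⟩ := hS (t₁ - t₂) (by
    rw [map_sub]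
    simpa using (ht₁.mono Set.inter_subset_left).sub (ht₂.mono Set.inter_subset_right))
  obtain ⟨t, h1, h2⟩ := exists_agree_of_agree_inter (s := t₁ - z) (t := t₂) h₁ h₂ (by
    simpa using (Agree.refl _ t₁).sub hzt)
  refine ⟨t, Agree.union ((h1.d j).trans ?_) ((h2.d j).trans ht₂)⟩
  rw [map_sub]
  simpa using ht₁.sub hz

lemma ExactNear.union [T2Space M] (h₁ : IsCompact K₁) (h₂ : IsCompact K₂)
    (hS : C.ExtendsTo i j (K₁ ∩ K₂) K₁) (hK₁ : C.ExactNear i j k K₁)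
    (hK₂ : C.ExactNear i j k K₂) : C.ExactNear i j k (K₁ ∪ K₂) := fun s hs ↦
  exists_primitive_union h₁ h₂ hS (hK₁ s (hs.mono Set.subset_union_left))
    (hK₂ s (hs.mono Set.subset_union_right))

/-- A closed section near `K₁` whose restriction to `K₁ ∩ K₂` extends over `K₂`. -/
lemma ExtendsTo.union_right [T2Space M] (h₁ : IsCompact K₁) (h₂ : IsCompact K₂)
    (hS : C.ExtendsTo i j (K₁ ∩ K₂) K₂) : C.ExtendsTo i j K₁ (K₁ ∪ K₂) := fun z hz ↦ by
  obtain ⟨z', hz', hzz'⟩ := hS z (hz.mono Set.inter_subset_left)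
  obtain ⟨r, h1, h2⟩ := exists_agree_of_agree_inter h₁ h₂ hzz'.symm
  exact ⟨r, ((h1.d j).trans hz).union ((h2.d j).trans hz'), h1⟩

lemma ExtendsTo.trans {K'' : Set M} (h₁ : C.ExtendsTo i j K K') (h₂ : C.ExtendsTo i j K' K'')
    (hK : K ⊆ K') : C.ExtendsTo i j K K'' := fun z hz ↦ by
  obtain ⟨z', hz', h⟩ := h₁ z hz
  obtain ⟨z'', hz'', h'⟩ := h₂ z' hz'
  exact ⟨z'', hz'', (h'.mono hK).trans h⟩

/-- Exactness on an increasing union of sets. -/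
lemma exactNear_univ_of_exhaustion (K : ℕ → Set M) (hK : ∀ n, K n ⊆ interior (K (n + 1)))
    (hU : ⋃ n, K n = Set.univ) (hE : ∀ n, C.ExactNear i j k (K n))
    (hS : ∀ n, C.ExtendsTo i j (K n) (K (n + 1))) : C.ExactNear i j k Set.univ := by
  intro s hs
  let P : (n : ℕ) → Type _ := fun n ↦ {t : C.sec i // C.Agree (K n) (C.d i j t) s}
  -- Mittag-Leffler: a primitive near the next set is corrected by a closed section so as to
  -- continue the given one, and the resulting sequence is stationary near each K n.
  have step : ∀ n (t : P n), ∃ t' : P (n + 1), C.Agree (K n) t'.1 t.1 := by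
    rintro n ⟨t, ht⟩
    obtain ⟨t', ht'⟩ := hE (n + 1) s (hs.mono (Set.subset_univ _))
    obtain ⟨z, hz, hzt⟩ := hS n (t' - t) (by
      rw [map_sub]
      simpa using (ht'.mono ((hK n).trans interior_subset)).sub ht)
    refine ⟨⟨t' - z, ?_⟩, ?_⟩
    · rw [map_sub]; simpa using ht'.sub hz
    · simpa using (Agree.refl _ t').sub hzt
  choose f hf using step
  obtain ⟨t₀, ht₀⟩ := hE 0 s (hs.mono (Set.subset_univ _))
  let t : (n : ℕ) → P n := fun n ↦ Nat.rec ⟨t₀, ht₀⟩ f n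
  have ht : ∀ n, C.Agree (K n) (t (n + 1)).1 (t n).1 := fun n ↦ hf n (t n)
  have hmono : Monotone K := monotone_nat_of_le_succ fun n ↦ (hK n).trans interior_subset
  have hle : ∀ n m, n ≤ m → C.Agree (K n) (t m).1 (t n).1 := fun n m hnm ↦ by
    induction m, hnm using Nat.le_induction with
    | base => exact Agree.refl _ _
    | succ m hnm ih => exact ((ht m).mono (hmono hnm)).trans ih
  obtain ⟨r, hr⟩ := C.glue (fun n ↦ interior (K n)) (fun _ ↦ isOpen_interior)
    (fun n ↦ (t n).1) (by
      intro a b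
      rcases le_total a b with hab | hab
      · exact ((hle a b hab).mono (Set.inter_subset_left.trans interior_subset)).symm
      · exact (hle b a hab).mono (Set.inter_subset_right.trans interior_subset))
  refine ⟨r, ?_⟩
  rw [← hU]
  refine Agree.of_iUnion fun n ↦ ?_
  have h1 : C.Agree (K n) r (t (n + 1)).1 := Agree.mono (hr (n + 1)) (hK n)
  exact (h1.d j).trans ((t (n + 1)).2.mono ((hK n).trans interior_subset))

end Exact

end SupportedComplex

/-! ### Cohomological dimension of compact sets -/

namespace SupportedComplex

variable {M : Type u} [TopologicalSpace M] {C : SupportedComplex.{u, v} M}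

variable (C) in
/-- The cohomological analogue of "`K` has dimension less than `m`". -/
structure DimLT (m : ℕ) (K : Set M) : Prop where
  exactNear : ∀ K' ⊆ K, IsCompact K' → ∀ j : ℤ, m ≤ j → C.ExactNear (j - 1) j (j + 1) K'
  extendsTo : ∀ K' K'', IsCompact K' → IsCompact K'' → K' ⊆ K'' → K'' ⊆ K →
    C.ExtendsTo (m - 1) m K' K''

namespace DimLT

variable {m : ℕ} {K K₁ K₂ : Set M}

lemma mono (h : C.DimLT m K) (hK : K₁ ⊆ K) : C.DimLT m K₁ where
  exactNear K' hK' := h.exactNear K' (hK'.trans hK)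
  extendsTo K' K'' h1 h2 h3 h4 := h.extendsTo K' K'' h1 h2 h3 (h4.trans hK)

lemma empty (m : ℕ) : C.DimLT m ∅ where
  exactNear K' hK' _ _ _ := by
    obtain rfl : K' = ∅ := Set.subset_empty_iff.1 hK'
    exact exactNear_empty
  extendsTo K' K'' _ _ h3 h4 := by
    obtain rfl : K'' = ∅ := Set.subset_empty_iff.1 h4
    obtain rfl : K' = ∅ := Set.subset_empty_iff.1 h3
    exact fun z hz ↦ ⟨z, hz, Agree.refl _ _⟩

/-- Above the critical degree m - 1 extension follows from exactness one degree lower; only the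
critical degree needs the separate clause of `DimLT`. -/
lemma extendsTo_of_le (h : C.DimLT m K) {K' K'' : Set M} (h1 : IsCompact K') (h2 : IsCompact K'')
    (h3 : K' ⊆ K'') (h4 : K'' ⊆ K) {j : ℤ} (hj : m ≤ j) : C.ExtendsTo (j - 1) j K' K'' := by
  obtain rfl | hj := hj.eq_or_lt
  · exact h.extendsTo K' K'' h1 h2 h3 h4
  · have := (h.exactNear K' (h3.trans h4) h1 (j - 1) (by lia)).extendsTo K''
    rwa [sub_add_cancel] at this

variable [T2Space M]

/-- Mayer–Vietoris for exactness: in degree m there is no exactness of degree m - 1 on the overlap,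
and the extension clause replaces it. Extension itself proceeds first over the part in K₁, then over
the part in K₂. -/
lemma union (h₁ : C.DimLT m K₁) (h₂ : C.DimLT m K₂) (hK₁ : IsCompact K₁) (hK₂ : IsCompact K₂) :
    C.DimLT m (K₁ ∪ K₂) where
  exactNear K' hK' hc j hj := by
    have e : K' = (K' ∩ K₁) ∪ (K' ∩ K₂) := by
      rw [← Set.inter_union_distrib_left, Set.inter_eq_left.2 hK']
    have c₁ := hc.inter hK₁
    have c₂ := hc.inter hK₂
    rw [e]
    exact ExactNear.union c₁ c₂ (h₁.extendsTo_of_le (c₁.inter c₂) c₁ Set.inter_subset_left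
      Set.inter_subset_right hj) (h₁.exactNear _ Set.inter_subset_right c₁ j hj)
      (h₂.exactNear _ Set.inter_subset_right c₂ j hj)
  extendsTo K' K'' hc' hc'' h3 h4 := by
    have c₁ := hc''.inter hK₁
    have c₂ := hc''.inter hK₂
    have e : K'' = (K' ∪ (K'' ∩ K₁)) ∪ (K'' ∩ K₂) := by
      rw [Set.union_assoc, ← Set.inter_union_distrib_left, Set.inter_eq_left.2 h4,
        Set.union_eq_right.2 h3]
    rw [e]
    exact ExtendsTo.trans (ExtendsTo.union_right hc' c₁ (h₁.extendsTo _ _ (hc'.inter c₁) c₁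
      Set.inter_subset_right Set.inter_subset_right))
      (ExtendsTo.union_right (hc'.union c₁) c₂ (h₂.extendsTo _ _ ((hc'.union c₁).inter c₂) c₂
      Set.inter_subset_right Set.inter_subset_right)) Set.subset_union_left

lemma biUnion {ι : Type*} (F : Finset ι) (K : ι → Set M) (hK : ∀ a ∈ F, IsCompact (K a))
    (h : ∀ a ∈ F, C.DimLT m (K a)) : C.DimLT m (⋃ a ∈ F, K a) := by
  classical
  induction F using Finset.induction_on with
  | empty => simpa using empty m
  | insert a F ha ih =>
    rw [Finset.set_biUnion_insert]
    exact (h a (by simp)).union (ih (fun b hb ↦ hK b (by simp [hb])) fun b hb ↦ h b (by simp [hb]))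
      (hK a (by simp)) (F.isCompact_biUnion fun b hb ↦ hK b (by simp [hb]))

/-- Primitives exist near points, hence on finitely many small closed pieces covering K. These are
glued one at a time, along overlaps contained in frontiers. -/
lemma exactNear_of_frontier (hK : IsCompact K)
    (hC : ∀ j : ℤ, 1 ≤ j → ∀ y, C.ExactNear (j - 1) j (j + 1) {y})
    (hV : ∀ x ∈ K, ∀ U, IsOpen U → x ∈ U →
      ∃ V, IsOpen V ∧ x ∈ V ∧ closure V ⊆ U ∧ C.DimLT m (K ∩ frontier V))
    (j : ℤ) (hj : m + 1 ≤ j) : C.ExactNear (j - 1) j (j + 1) K := by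
  classical
  intro s hs
  have h1 : ∀ x : K, ∃ V, IsOpen V ∧ x.1 ∈ V ∧ C.DimLT m (K ∩ frontier V) ∧
      ∃ t, C.Agree (closure V) (C.d (j - 1) j t) s := by
    rintro ⟨x, hx⟩
    obtain ⟨t, ht⟩ := hC j (by lia) x s (hs.mono (Set.singleton_subset_iff.2 hx))
    obtain ⟨U, hU, hxU, htU⟩ := ht.exists_open
    obtain ⟨V, hV, hxV, hVU, hd⟩ := hV x hx U hU (hxU rfl)
    exact ⟨V, hV, hxV, hd, t, htU.mono hVU⟩
  choose V hVo hxV hd ht using h1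
  obtain ⟨F, hF⟩ := hK.elim_finite_subcover V hVo
    fun x hx ↦ Set.mem_iUnion.2 ⟨⟨x, hx⟩, hxV ⟨x, hx⟩⟩
  have key : ∀ F : Finset K, ∃ t, C.Agree (⋃ a ∈ F, K ∩ closure (V a)) (C.d (j - 1) j t) s := by
    intro F
    induction F using Finset.induction_on with
    | empty => exact ⟨0, by simpa using Agree.of_empty⟩
    | insert a F _ ih =>
      have hc : ∀ b, IsCompact (K ∩ closure (V b)) := fun b ↦ hK.inter_right isClosed_closure
      have hA : IsCompact (⋃ b ∈ F, K ∩ closure (V b)) := F.isCompact_biUnion fun b _ ↦ hc b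
      -- Removing the open sets already treated pushes the overlap with the earlier pieces into
      -- their frontiers, where degree j - 1 ≥ m is exact.
      have hL : IsCompact ((K ∩ closure (V a)) \ ⋃ b ∈ F, V b) :=
        (hc a).diff (isOpen_biUnion fun b _ ↦ hVo b)
      have hdim : C.DimLT m (⋃ b ∈ F, K ∩ frontier (V b)) :=
        biUnion F _ (fun b _ ↦ hK.inter_right isClosed_frontier) fun b _ ↦ hd b
      have hsub : (⋃ b ∈ F, K ∩ closure (V b)) ∩ ((K ∩ closure (V a)) \ ⋃ b ∈ F, V b) ⊆
          ⋃ b ∈ F, K ∩ frontier (V b) := by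
        rintro x ⟨hx1, -, hx2⟩
        simp only [Set.mem_iUnion, not_exists] at hx1 hx2 ⊢
        obtain ⟨b, hb, hxK, hxb⟩ := hx1
        exact ⟨b, hb, hxK, (hVo b).frontier_eq ▸ ⟨hxb, hx2 b hb⟩⟩
      obtain ⟨t, ht⟩ := exists_primitive_union hA hL
        (by
          have := (hdim.exactNear _ hsub (hA.inter hL) (j - 1) (by lia)).extendsTo
            (⋃ b ∈ F, K ∩ closure (V b))
          rwa [sub_add_cancel] at this) ih
        (by
          obtain ⟨t, ht'⟩ := ht a
          exact ⟨t, ht'.mono fun x hx ↦ hx.1.2⟩)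
      refine ⟨t, ht.mono ?_⟩
      rw [Finset.set_biUnion_insert]
      rintro x (hx | hx)
      · by_cases hxF : x ∈ ⋃ b ∈ F, V b
        · left
          simp only [Set.mem_iUnion] at hxF ⊢
          obtain ⟨b, hb, hxb⟩ := hxF
          exact ⟨b, hb, hx.1, subset_closure hxb⟩
        · exact Or.inr ⟨hx, hxF⟩
      · exact Or.inl hx
  obtain ⟨t, ht⟩ := key F
  refine ⟨t, ht.mono fun x hx ↦ ?_⟩
  have := hF hx
  simp only [Set.mem_iUnion] at this ⊢
  obtain ⟨b, hb, hxb⟩ := this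
  exact ⟨b, hb, hx, subset_closure hxb⟩

/-- The section is closed on a slightly larger neighbourhood of K', cut out by finitely many small
V. It must be continued only across their frontiers, where it is exact and so extends. -/
lemma extendsTo_of_frontier (hK : IsCompact K) {K' : Set M} (hK' : IsCompact K') (hKK' : K' ⊆ K)
    (hV : ∀ x ∈ K, ∀ U, IsOpen U → x ∈ U →
      ∃ V, IsOpen V ∧ x ∈ V ∧ closure V ⊆ U ∧ C.DimLT m (K ∩ frontier V)) :
    C.ExtendsTo m (m + 1) K' K := by
  classical
  intro z hz
  obtain ⟨U, hU, hKU, hzU⟩ := hz.exists_open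
  have h1 : ∀ x : K', ∃ V, IsOpen V ∧ x.1 ∈ V ∧ closure V ⊆ U ∧ C.DimLT m (K ∩ frontier V) :=
    fun x ↦ hV x (hKK' x.2) U hU (hKU x.2)
  choose V hVo hxV hVU hd using h1
  obtain ⟨F, hF⟩ := hK'.elim_finite_subcover V hVo
    fun x hx ↦ Set.mem_iUnion.2 ⟨⟨x, hx⟩, hxV ⟨x, hx⟩⟩
  have hA : IsCompact (⋃ b ∈ F, K ∩ closure (V b)) :=
    F.isCompact_biUnion fun b _ ↦ hK.inter_right isClosed_closure
  have hL : IsCompact (K \ ⋃ b ∈ F, V b) := hK.diff (isOpen_biUnion fun b _ ↦ hVo b)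
  have hdim : C.DimLT m (⋃ b ∈ F, K ∩ frontier (V b)) :=
    biUnion F _ (fun b _ ↦ hK.inter_right isClosed_frontier) fun b _ ↦ hd b
  have hsub : (⋃ b ∈ F, K ∩ closure (V b)) ∩ (K \ ⋃ b ∈ F, V b) ⊆
      ⋃ b ∈ F, K ∩ frontier (V b) := by
    rintro x ⟨hx1, -, hx2⟩
    simp only [Set.mem_iUnion, not_exists] at hx1 hx2 ⊢
    obtain ⟨b, hb, hxK, hxb⟩ := hx1
    exact ⟨b, hb, hxK, (hVo b).frontier_eq ▸ ⟨hxb, hx2 b hb⟩⟩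
  obtain ⟨z', hz', h⟩ := ExtendsTo.union_right (C := C) hA hL
    ((hdim.exactNear _ hsub (hA.inter hL) m le_rfl).extendsTo _) z (hzU.mono (by
      simp only [Set.iUnion_subset_iff]
      exact fun b _ ↦ Set.inter_subset_right.trans (hVU b)))
  refine ⟨z', hz'.mono fun x hx ↦ ?_, h.mono fun x hx ↦ ?_⟩
  · by_cases hxF : x ∈ ⋃ b ∈ F, V b
    · left
      simp only [Set.mem_iUnion] at hxF ⊢
      obtain ⟨b, hb, hxb⟩ := hxF
      exact ⟨b, hb, hx, subset_closure hxb⟩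
    · exact Or.inr ⟨hx, hxF⟩
  · have := hF hx
    simp only [Set.mem_iUnion] at this ⊢
    obtain ⟨b, hb, hxb⟩ := this
    exact ⟨b, hb, hKK' hx, subset_closure hxb⟩

/-- The dimension is bounded inductively by the dimension of boundaries of small neighbourhoods. -/
lemma succ (hC : ∀ j : ℤ, 1 ≤ j → ∀ y, C.ExactNear (j - 1) j (j + 1) {y})
    (hV : ∀ x ∈ K, ∀ U, IsOpen U → x ∈ U →
      ∃ V, IsOpen V ∧ x ∈ V ∧ closure V ⊆ U ∧ C.DimLT m (K ∩ frontier V)) :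
    C.DimLT (m + 1) K := by
  have hV' : ∀ K' ⊆ K, ∀ x ∈ K', ∀ U, IsOpen U → x ∈ U →
      ∃ V, IsOpen V ∧ x ∈ V ∧ closure V ⊆ U ∧ C.DimLT m (K' ∩ frontier V) :=
    fun K' hK' x hx U hU hxU ↦ by
      obtain ⟨V, h1, h2, h3, h4⟩ := hV x (hK' hx) U hU hxU
      exact ⟨V, h1, h2, h3, h4.mono (Set.inter_subset_inter_left _ hK')⟩
  refine ⟨fun K' hK' hc j hj ↦ exactNear_of_frontier hc hC (hV' K' hK') j (by exact_mod_cast hj),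
    fun K' K'' hc' hc'' h3 h4 ↦ ?_⟩
  have := extendsTo_of_frontier hc'' hc' h3 (hV' K'' h4)
  simpa using this

/-- T lists the coordinates frozen on K, so K has dimension at most d - |T|, and `hm` says that this
is less than m. Each induction step freezes one more coordinate. -/
lemma of_subset_image {d : ℕ} {c : (Fin d → ℝ) → M} (hc : Topology.IsOpenEmbedding c)
    (hC : ∀ j : ℤ, 1 ≤ j → ∀ y, C.ExactNear (j - 1) j (j + 1) {y})
    (m : ℕ) (T : Finset (Fin d)) (p : Fin d → ℝ) (hm : d + 1 ≤ T.card + m) (K : Set M)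
    (hK : IsCompact K) (hKc : K ⊆ c '' {x | ∀ i ∈ T, x i = p i}) : C.DimLT m K := by
  classical
  induction m generalizing T p K with
  | zero =>
    have := T.card_le_univ
    simp at this
    lia
  | succ m ih =>
    refine succ hC fun x hx U hU hxU ↦ ?_
    obtain ⟨v, hv, rfl⟩ := hKc hx
    obtain ⟨ε, hε, hεU⟩ := Metric.nhds_basis_closedBall.mem_iff.1
      ((hU.preimage hc.continuous).mem_nhds hxU)
    have hcc : IsCompact (c '' Metric.closedBall v ε) :=
      (isCompact_closedBall v ε).image hc.continuous
    have hcl : closure (c '' Metric.ball v ε) ⊆ c '' Metric.closedBall v ε :=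
      closure_minimal (Set.image_mono Metric.ball_subset_closedBall) hcc.isClosed
    have hVo : IsOpen (c '' Metric.ball v ε) := hc.isOpenMap _ Metric.isOpen_ball
    refine ⟨c '' Metric.ball v ε, hVo, ⟨v, Metric.mem_ball_self hε, rfl⟩,
      hcl.trans (Set.image_subset_iff.2 hεU), ?_⟩
    -- For the sup norm a ball is a cube; the index runs over its 2d faces, the boolean choosing the
    -- sign of ε.
    let S : Fin d × Bool → Set (Fin d → ℝ) := fun a ↦
      Metric.closedBall v ε ∩ {x | x a.1 = v a.1 + bif a.2 then ε else -ε}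
    have hS : ∀ a, IsCompact (K ∩ c '' S a) := fun a ↦ hK.inter
      (((isCompact_closedBall v ε).inter_right
        (isClosed_eq (continuous_apply _) continuous_const)).image hc.continuous)
    refine (biUnion (Finset.univ.filter fun a : Fin d × Bool ↦ a.1 ∉ T) _ (fun a _ ↦ hS a)
      fun a ha ↦ ih (insert a.1 T) (Function.update p a.1 (v a.1 + bif a.2 then ε else -ε)) ?_ _
        (hS a) ?_).mono ?_
    · rw [Finset.card_insert_of_notMem (by simpa using ha)]
      lia
    · rintro _ ⟨hyK, y, hy, rfl⟩
      refine ⟨y, fun i hi ↦ ?_, rfl⟩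
      by_cases hia : i = a.1
      · subst hia
        simpa using hy.2
      · rw [Function.update_of_ne hia]
        obtain ⟨y', hy', e⟩ := hKc hyK
        rw [← hc.injective e]
        exact hy' i ((Finset.mem_insert.1 hi).resolve_left hia)
    · rintro y ⟨hyK, hy⟩
      rw [hVo.frontier_eq] at hy
      obtain ⟨y, hyb, rfl⟩ := hcl hy.1
      have hy2 : y ∉ Metric.ball v ε := fun h ↦ hy.2 ⟨y, h, rfl⟩
      rw [Metric.mem_ball, dist_pi_lt_iff hε] at hy2
      push Not at hy2
      obtain ⟨i, hi⟩ := hy2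
      have hi' : |y i - v i| = ε := le_antisymm
        ((dist_le_pi_dist y v i).trans (Metric.mem_closedBall.1 hyb)) hi
      -- A frozen coordinate is constant on K, so K misses the two faces in that direction.
      have hiT : i ∉ T := fun hiT ↦ by
        obtain ⟨y', hy', e⟩ := hKc hyK
        rw [hc.injective e] at hy'
        rw [hy' i hiT, hv i hiT, sub_self, abs_zero] at hi'
        exact hε.ne hi'
      simp only [Set.mem_iUnion]
      rcases eq_or_eq_neg_of_abs_eq hi' with h | h
      · exact ⟨(i, true), by simpa using hiT, hyK, y, ⟨hyb, by simp; linarith⟩, rfl⟩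
      · exact ⟨(i, false), by simpa using hiT, hyK, y, ⟨hyb, by simp; linarith⟩, rfl⟩

/-- Compact subsets of a `d`-dimensional manifold have dimension at most `d`. -/
lemma of_charts {d : ℕ}
    (hM : ∀ y : M, ∃ c : (Fin d → ℝ) → M, Topology.IsOpenEmbedding c ∧ y ∈ Set.range c)
    (hC : ∀ j : ℤ, 1 ≤ j → ∀ y, C.ExactNear (j - 1) j (j + 1) {y}) (hK : IsCompact K) :
    C.DimLT (d + 1) K := by
  obtain ⟨K', -, hKK', h⟩ := hK.induction_on (p := fun s ↦ ∃ K', IsCompact K' ∧ s ⊆ K' ∧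
      C.DimLT (d + 1) K') ⟨∅, isCompact_empty, subset_rfl, empty _⟩
    (fun s t hst ⟨K', h1, h2, h3⟩ ↦ ⟨K', h1, hst.trans h2, h3⟩)
    (fun s t ⟨K', h1, h2, h3⟩ ⟨K'', h1', h2', h3'⟩ ↦
      ⟨K' ∪ K'', h1.union h1', Set.union_subset_union h2 h2', h3.union h3' h1 h1'⟩)
    (fun y _ ↦ by
      obtain ⟨c, hc, v, rfl⟩ := hM y
      have hcc : IsCompact (c '' Metric.closedBall v 1) :=
        (isCompact_closedBall v 1).image hc.continuous
      refine ⟨c '' Metric.closedBall v 1, mem_nhdsWithin_of_mem_nhds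
        (hc.isOpenMap.image_mem_nhds (Metric.closedBall_mem_nhds v one_pos)), _, hcc, subset_rfl,
        of_subset_image hc hC (d + 1) ∅ 0 (by simp) _ hcc (Set.image_mono fun _ _ ↦ by simp)⟩)
  exact h.mono hKK'

end DimLT

/-- On a `d`-dimensional manifold, a locally exact complex is exact in degrees greater than `d`. -/
theorem exactNear_univ_of_charts [T2Space M] [WeaklyLocallyCompactSpace M] [SigmaCompactSpace M]
    {d : ℕ}
    (hM : ∀ y : M, ∃ c : (Fin d → ℝ) → M, Topology.IsOpenEmbedding c ∧ y ∈ Set.range c)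
    (hC : ∀ j : ℤ, 1 ≤ j → ∀ y, C.ExactNear (j - 1) j (j + 1) {y}) (j : ℤ) (hj : d + 1 ≤ j) :
    C.ExactNear (j - 1) j (j + 1) Set.univ := by
  let E := CompactExhaustion.choice M
  have hd : ∀ n, C.DimLT (d + 1) (E n) := fun n ↦ DimLT.of_charts hM hC (E.isCompact n)
  exact exactNear_univ_of_exhaustion (fun n ↦ E n) E.subset_interior_succ E.iUnion_eq
    (fun n ↦ (hd n).exactNear _ subset_rfl (E.isCompact n) j (by exact_mod_cast hj))
    (fun n ↦ (hd (n + 1)).extendsTo_of_le (E.isCompact n) (E.isCompact _) (E.subset_succ n)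
      subset_rfl (by exact_mod_cast hj))

end SupportedComplex

/-! ### Subdivision of boxes and the Poincaré lemma -/

/-- Induction on boxes: a property of boxes which holds for small boxes and which passes from the
two halves of a box to the box holds for all boxes. -/
lemma box_induction {n : ℕ} {p : (Fin n → ℝ) → (Fin n → ℝ) → Prop} {a b : Fin n → ℝ}
    (h_loc : ∀ z ∈ Set.Icc a b, ∃ U, IsOpen U ∧ z ∈ U ∧
      ∀ a' b', a' ≤ b' → Set.Icc a' b' ⊆ U ∩ Set.Icc a b → p a' b')
    (h_merge : ∀ a' b', a' ≤ b' → Set.Icc a' b' ⊆ Set.Icc a b → ∀ i t, a' i ≤ t → t ≤ b' i →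
      p a' (Function.update b' i t) → p (Function.update a' i t) b' → p a' b')
    (hab : a ≤ b) : p a b := by
  classical
  choose! U hUo hzU hU using h_loc
  obtain ⟨ε, hε, hεU⟩ := lebesgue_number_lemma_of_metric (isCompact_Icc (a := a) (b := b))
    (c := fun z : Set.Icc a b ↦ U z) (fun z ↦ hUo z z.2)
    (fun z hz ↦ Set.mem_iUnion.2 ⟨⟨z, hz⟩, hzU z hz⟩)
  -- T contains the directions in which the side may still exceed the Lebesgue number ε.
  have key : ∀ (T : Finset (Fin n)) (a' b' : Fin n → ℝ), a' ≤ b' →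
      Set.Icc a' b' ⊆ Set.Icc a b → (∀ i ∉ T, b' i - a' i < ε) → p a' b' := by
    intro T
    induction T using Finset.induction_on with
    | empty =>
      intro a' b' hab' hsub hlt
      obtain ⟨z, hz⟩ := hεU a' (hsub ⟨le_rfl, hab'⟩)
      refine hU z z.2 a' b' hab' (Set.subset_inter (fun x hx ↦ hz ?_) hsub)
      rw [Metric.mem_ball, dist_pi_lt_iff hε]
      intro i
      rw [Real.dist_eq, abs_of_nonneg (sub_nonneg.2 (hx.1 i))]
      linarith [hx.2 i, hlt i (by simp)]
    | insert i T _ ih =>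
      intro a' b' hab' hsub hlt
      -- N bounds the number of slabs of width ε / 2 to be cut off before the side in direction i
      -- drops below ε.
      obtain ⟨N, hN⟩ : ∃ N : ℕ, b' i - a' i < ε + N * (ε / 2) := by
        obtain ⟨N, hN⟩ := exists_nat_gt ((b' i - a' i) / (ε / 2))
        rw [div_lt_iff₀ (by positivity)] at hN
        exact ⟨N, by linarith⟩
      induction N generalizing a' with
      | zero =>
        refine ih a' b' hab' hsub fun l hl ↦ ?_
        by_cases hli : l = i
        · subst hli; simpa using hN
        · exact hlt l (by simp [hli, hl])
      | succ N ihN =>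
        by_cases hsm : b' i - a' i < ε
        · refine ih a' b' hab' hsub fun l hl ↦ ?_
          by_cases hli : l = i
          · subst hli; simpa using hsm
          · exact hlt l (by simp [hli, hl])
        · have h1 : a' ≤ Function.update b' i (a' i + ε / 2) := by
            rw [le_update_iff]
            exact ⟨by linarith, fun j _ ↦ hab' j⟩
          have h2 : Function.update a' i (a' i + ε / 2) ≤ b' := by
            rw [update_le_iff]
            exact ⟨by linarith, fun j _ ↦ hab' j⟩
          refine h_merge a' b' hab' hsub i (a' i + ε / 2) (by linarith) (by linarith) ?_ ?_
          · refine ih _ _ h1 (subset_trans (Set.Icc_subset_Icc_right ?_) hsub) fun l hl ↦ ?_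
            · rw [update_le_iff]
              exact ⟨by linarith, fun _ _ ↦ le_rfl⟩
            · by_cases hli : l = i
              · subst hli; simp; linarith
              · rw [Function.update_of_ne hli]
                exact hlt l (by simp [hli, hl])
          · refine ihN _ h2 (subset_trans (Set.Icc_subset_Icc_left ?_) hsub) (fun l hl ↦ ?_) ?_
            · rw [le_update_iff]
              exact ⟨by linarith, fun _ _ ↦ le_rfl⟩
            · have hli : l ≠ i := fun h ↦ hl (by simp [h])
              rw [Function.update_of_ne hli]
              exact hlt l hl
            · simp only [Function.update_self]
              push_cast at hN
              linarith
  exact key Finset.univ a b hab subset_rfl (by simp)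

namespace SupportedComplex

variable {M : Type u} [TopologicalSpace M] (C : SupportedComplex.{u, v} M)

/-- The sheaf of closed sections of degree `0` is locally constant. -/
def IsLocallyConstant : Prop :=
  ∀ y : M, ∃ V, IsOpen V ∧ y ∈ V ∧ ∃ A : Set (C.sec 0),
    (∀ a ∈ A, C.Agree V (C.d 0 1 a) 0) ∧
    (∀ z ∈ V, ∀ g, C.Agree {z} (C.d 0 1 g) 0 → ∃ a ∈ A, C.Agree {z} g a) ∧
    (∀ a ∈ A, ∀ b ∈ A, ∀ z ∈ V, C.Agree {z} a b → C.Agree V a b)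

variable {C}

/-- The identity principle for closed sections of degree `0`. -/
lemma IsLocallyConstant.agree (hC : C.IsLocallyConstant) {K : Set M} (hK : IsPreconnected K)
    {g₁ g₂ : C.sec 0} (h₁ : C.Agree K (C.d 0 1 g₁) 0) (h₂ : C.Agree K (C.d 0 1 g₂) 0)
    {x : M} (hx : x ∈ K) (h : C.Agree {x} g₁ g₂) : C.Agree K g₁ g₂ := by
  -- Agreement is an open condition; by local constancy so is disagreement of closed sections, and
  -- connectedness of K decides.
  have hsub : K ⊆ (C.supp (g₁ - g₂))ᶜ ∪ interior (C.supp (g₁ - g₂)) := by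
    intro y hy
    by_cases hys : C.Agree {y} g₁ g₂
    · exact Or.inl (Set.disjoint_singleton_right.1 hys)
    · right
      obtain ⟨V, hV, hyV, A, -, hA, hAA⟩ := hC y
      obtain ⟨a, ha, h1⟩ := hA y hyV g₁ (h₁.mono (Set.singleton_subset_iff.2 hy))
      obtain ⟨b, hb, h2⟩ := hA y hyV g₂ (h₂.mono (Set.singleton_subset_iff.2 hy))
      obtain ⟨U₁, hU₁, hy₁, h1⟩ := h1.exists_open
      obtain ⟨U₂, hU₂, hy₂, h2⟩ := h2.exists_open
      refine mem_interior.2 ⟨V ∩ (U₁ ∩ U₂), fun z hz ↦ ?_, hV.inter (hU₁.inter hU₂),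
        hyV, hy₁ rfl, hy₂ rfl⟩
      by_contra hzs
      have hz' : C.Agree {z} g₁ g₂ := Set.disjoint_singleton_right.2 hzs
      refine hys ?_
      have hab := hAA a ha b hb z hz.1
        (((h1.mono (Set.singleton_subset_iff.2 hz.2.1)).symm.trans hz').trans
          (h2.mono (Set.singleton_subset_iff.2 hz.2.2)))
      exact ((h1.mono hy₁).trans (hab.mono (Set.singleton_subset_iff.2 hyV))).trans
        (h2.mono hy₂).symm
  have := hK.subset_left_of_subset_union (C.isClosed_supp _).isOpen_compl isOpen_interior
    (Disjoint.mono_right interior_subset disjoint_compl_left) hsub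
    ⟨x, hx, Set.disjoint_singleton_right.1 h⟩
  exact Set.subset_compl_iff_disjoint_left.1 this

/-- Extend the germ at one point of K; by the identity principle the extension matches the given
section on all of K. -/
lemma IsLocallyConstant.extendsTo (hC : C.IsLocallyConstant) {K K' : Set M}
    (hK : IsPreconnected K) (hne : K.Nonempty) (hK' : ∀ x ∈ K', C.ExtendsTo 0 1 {x} K')
    (hKK' : K ⊆ K') : C.ExtendsTo 0 1 K K' := fun z hz ↦ by
  obtain ⟨x, hx⟩ := hne
  obtain ⟨z', hz', h⟩ := hK' x (hKK' hx) z (hz.mono (Set.singleton_subset_iff.2 hx))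
  exact ⟨z', hz', hC.agree hK (hz'.mono hKK') hz hx h⟩

lemma IsLocallyConstant.extendsTo_union [T2Space M] (hC : C.IsLocallyConstant) {K₁ K₂ : Set M}
    (h₁ : IsCompact K₁) (h₂ : IsCompact K₂) (hK : IsPreconnected (K₁ ∩ K₂))
    (hne : (K₁ ∩ K₂).Nonempty) (hK₁ : ∀ x ∈ K₁, C.ExtendsTo 0 1 {x} K₁)
    (hK₂ : ∀ x ∈ K₂, C.ExtendsTo 0 1 {x} K₂) :
    ∀ x ∈ K₁ ∪ K₂, C.ExtendsTo 0 1 {x} (K₁ ∪ K₂) := by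
  rintro x (hx | hx)
  · exact (hK₁ x hx).trans (ExtendsTo.union_right h₁ h₂
      (hC.extendsTo hK hne hK₂ Set.inter_subset_right)) (Set.singleton_subset_iff.2 hx)
  · rw [Set.union_comm]
    rw [Set.inter_comm] at hK hne
    exact (hK₂ x hx).trans (ExtendsTo.union_right h₂ h₁
      (hC.extendsTo hK hne hK₁ Set.inter_subset_right)) (Set.singleton_subset_iff.2 hx)

end SupportedComplex

section Boxes

variable {n : ℕ} {a b : Fin n → ℝ}

lemma Icc_update_union {i : Fin n} {t : ℝ} (h1 : a i ≤ t) (h2 : t ≤ b i) :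
    Set.Icc a (Function.update b i t) ∪ Set.Icc (Function.update a i t) b = Set.Icc a b := by
  ext x
  simp only [Set.mem_union, Set.mem_Icc, le_update_iff, update_le_iff]
  constructor
  · rintro (⟨h, h3, h4⟩ | ⟨⟨h3, h4⟩, h⟩)
    · refine ⟨h, fun j ↦ ?_⟩
      by_cases hj : j = i
      · subst hj; exact h3.trans h2
      · exact h4 j hj
    · refine ⟨fun j ↦ ?_, h⟩
      by_cases hj : j = i
      · subst hj; exact h1.trans h3
      · exact h4 j hj
  · rintro ⟨h3, h4⟩
    rcases le_total (x i) t with h | h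
    · exact Or.inl ⟨h3, h, fun j _ ↦ h4 j⟩
    · exact Or.inr ⟨⟨h, fun j _ ↦ h3 j⟩, h4⟩

lemma Icc_update_inter (hab : a ≤ b) {i : Fin n} {t : ℝ} (h1 : a i ≤ t) (h2 : t ≤ b i) :
    Set.Icc a (Function.update b i t) ∩ Set.Icc (Function.update a i t) b =
      Set.Icc (Function.update a i t) (Function.update b i t) ∧
    Function.update a i t ≤ Function.update b i t := by
  refine ⟨?_, fun j ↦ ?_⟩
  · rw [Set.Icc_inter_Icc, sup_eq_right.2, inf_eq_left.2]
    · rw [update_le_iff]; exact ⟨h2, fun _ _ ↦ le_rfl⟩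
    · rw [le_update_iff]; exact ⟨h1, fun _ _ ↦ le_rfl⟩
  · by_cases hj : j = i
    · subst hj; simp
    · simpa [hj] using hab j

lemma isPreconnected_box : _root_.IsPreconnected (Set.Icc a b) := (convex_Icc a b).isPreconnected

namespace SupportedComplex

variable {C : SupportedComplex (Fin n → ℝ)}

/-- A locally constant sheaf on a box has no monodromy: germs extend over small boxes, and two
halves meet in a nonempty connected box, so extensions continue from one half to the other. -/
lemma IsLocallyConstant.extendsTo_box (hC : C.IsLocallyConstant) (hab : a ≤ b) :
    ∀ x ∈ Set.Icc a b, C.ExtendsTo 0 1 {x} (Set.Icc a b) := by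
  refine box_induction (p := fun a b ↦ ∀ x ∈ Set.Icc a b, C.ExtendsTo 0 1 {x} (Set.Icc a b))
    ?_ ?_ hab
  · intro z _
    obtain ⟨V, hV, hzV, A, hAd, hA, -⟩ := hC z
    refine ⟨V, hV, hzV, fun a' b' _ hsub x hx g hg ↦ ?_⟩
    obtain ⟨α, hα, h⟩ := hA x (hsub hx).1 g hg
    exact ⟨α, (hAd α hα).mono fun y hy ↦ (hsub hy).1, h.symm⟩
  · intro a' b' hab' _ i t h1 h2 h3 h4
    obtain ⟨e, hle⟩ := Icc_update_inter hab' h1 h2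
    have := hC.extendsTo_union isCompact_Icc isCompact_Icc (by rw [e]; exact isPreconnected_box)
      (by rw [e]; exact Set.nonempty_Icc.2 hle) h3 h4
    rwa [Icc_update_union h1 h2] at this

/-- The Poincaré lemma on boxes. -/
lemma IsLocallyConstant.exactNear_box (hC : C.IsLocallyConstant)
    (hE : ∀ j : ℤ, 1 ≤ j → ∀ y, C.ExactNear (j - 1) j (j + 1) {y}) (j : ℤ) (hj : 1 ≤ j)
    (hab : a ≤ b) : C.ExactNear (j - 1) j (j + 1) (Set.Icc a b) := by
  induction j, hj using Int.leInduction generalizing a b with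
  | base =>
    intro s hs
    refine box_induction (p := fun a b ↦ ∃ t, C.Agree (Set.Icc a b) (C.d (1 - 1) 1 t) s) ?_ ?_ hab
    · intro z hz
      obtain ⟨t, ht⟩ := hE 1 le_rfl z s (hs.mono (Set.singleton_subset_iff.2 hz))
      obtain ⟨U, hU, hzU, htU⟩ := ht.exists_open
      exact ⟨U, hU, hzU rfl, fun a' b' _ hsub ↦ ⟨t, htU.mono fun x hx ↦ (hsub hx).1⟩⟩
    · intro a' b' hab' _ i t h1 h2 h3 h4
      obtain ⟨e, hle⟩ := Icc_update_inter hab' h1 h2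
      rw [← Icc_update_union h1 h2]
      -- In degree 1 the primitives differ on the common face by a closed section of degree 0, which
      -- extends by local constancy.
      refine exists_primitive_union isCompact_Icc isCompact_Icc ?_ h3 h4
      rw [e]
      refine hC.extendsTo isPreconnected_box (Set.nonempty_Icc.2 hle) (hC.extendsTo_box ?_) ?_
      · exact (le_update_iff.2 ⟨h1, fun j _ ↦ hab' j⟩)
      · exact Set.Icc_subset_Icc_left (le_update_iff.2 ⟨h1, fun _ _ ↦ le_rfl⟩)
  | succ j hj ih =>
    intro s hs
    refine box_induction
      (p := fun a b ↦ ∃ t, C.Agree (Set.Icc a b) (C.d (j + 1 - 1) (j + 1) t) s) ?_ ?_ hab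
    · intro z hz
      obtain ⟨t, ht⟩ := hE (j + 1) (by lia) z s (hs.mono (Set.singleton_subset_iff.2 hz))
      obtain ⟨U, hU, hzU, htU⟩ := ht.exists_open
      exact ⟨U, hU, hzU rfl, fun a' b' _ hsub ↦ ⟨t, htU.mono fun x hx ↦ (hsub hx).1⟩⟩
    · intro a' b' hab' _ i t h1 h2 h3 h4
      obtain ⟨e, hle⟩ := Icc_update_inter hab' h1 h2
      rw [← Icc_update_union h1 h2]
      -- In higher degrees the difference is exact on the common face, itself a box, by the
      -- induction hypothesis.
      refine exists_primitive_union isCompact_Icc isCompact_Icc ?_ h3 h4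
      rw [e, add_sub_cancel_right]
      exact (ih hle).extendsTo _

/-- The Poincaré lemma on `ℝⁿ`. -/
theorem IsLocallyConstant.exactNear_univ (hC : C.IsLocallyConstant)
    (hE : ∀ j : ℤ, 1 ≤ j → ∀ y, C.ExactNear (j - 1) j (j + 1) {y}) (j : ℤ) (hj : 1 ≤ j) :
    C.ExactNear (j - 1) j (j + 1) Set.univ := by
  let K : ℕ → Set (Fin n → ℝ) := fun N ↦ Set.Icc (fun _ ↦ -N) (fun _ ↦ N)
  have hle : ∀ N : ℕ, (fun _ : Fin n ↦ (-N : ℝ)) ≤ fun _ ↦ (N : ℝ) :=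
    fun N _ ↦ by simp only; linarith [(Nat.cast_nonneg N : (0 : ℝ) ≤ N)]
  have hsub : ∀ N, K N ⊆ interior (K (N + 1)) := fun N ↦ by
    simp only [K]
    rw [← Set.pi_univ_Icc, ← Set.pi_univ_Icc, interior_pi_set Set.finite_univ]
    refine Set.pi_mono fun i _ ↦ ?_
    rw [interior_Icc]
    intro x hx
    push_cast
    exact ⟨by linarith [hx.1], by linarith [hx.2]⟩
  refine exactNear_univ_of_exhaustion K hsub ?_ (fun N ↦ hC.exactNear_box hE j hj (hle N)) ?_
  · refine Set.eq_univ_of_forall fun x ↦ Set.mem_iUnion.2 ?_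
    obtain ⟨N, hN⟩ := exists_nat_ge ‖x‖
    exact ⟨N, fun i ↦ (abs_le.1 ((norm_le_pi_norm x i).trans hN)).1,
      fun i ↦ (abs_le.1 ((norm_le_pi_norm x i).trans hN)).2⟩
  · intro N
    obtain rfl | hj := hj.eq_or_lt
    · exact hC.extendsTo isPreconnected_box (Set.nonempty_Icc.2 (hle N))
        (hC.extendsTo_box (hle (N + 1))) ((hsub N).trans interior_subset)
    · have := (hC.exactNear_box hE (j - 1) (by lia) (hle N)).extendsTo (K (N + 1))
      rwa [sub_add_cancel] at this

end SupportedComplex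

end Boxes

/-! ### Open cones and distinguished neighbourhoods -/

/-- Lets charts be shrunk while keeping a whole vector space as parameter domain. -/
lemma exists_isOpenEmbedding_ball {E : Type*} [NormedAddCommGroup E] [NormedSpace ℝ E] (v : E)
    {r : ℝ} (hr : 0 < r) :
    ∃ β : E → E, Topology.IsOpenEmbedding β ∧ Set.range β = Metric.ball v r := by
  refine ⟨OpenPartialHomeomorph.univBall v r, OpenPartialHomeomorph.isOpenEmbedding _
    (OpenPartialHomeomorph.univBall_source v r), ?_⟩
  rw [← OpenPartialHomeomorph.univBall_target v hr, ← OpenPartialHomeomorph.image_source_eq_target,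
    OpenPartialHomeomorph.univBall_source, Set.image_univ]

namespace OpenCone

variable {L : Type u}

/-- The distance to the vertex. -/
def height : OpenCone L → ℝ :=
  Quot.lift (Sum.elim (fun _ ↦ 0) fun z ↦ z.2) (by rintro _ _ ⟨y⟩; rfl)

/-- The coordinates of a point different from the vertex. -/
noncomputable def coord : OpenCone L → Option (L × ℝ) :=
  open Classical in
  Quot.lift (Sum.elim (fun _ ↦ none) fun z ↦ if (z.2 : ℝ) = 0 then none else some (z.1, z.2))
    (by rintro _ _ ⟨y⟩; simp)

@[simp] lemma height_vertex : (vertex : OpenCone L).height = 0 := rfl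

@[simp] lemma height_mk (y : L) (t : Set.Ico (0 : ℝ) 1) : (mk y t).height = t := rfl

@[simp] lemma coord_vertex : (vertex : OpenCone L).coord = none := rfl

lemma coord_mk (y : L) {t : Set.Ico (0 : ℝ) 1} (ht : 0 < (t : ℝ)) :
    (mk y t).coord = some (y, (t : ℝ)) := if_neg ht.ne'

lemma mk_zero (y : L) {t : Set.Ico (0 : ℝ) 1} (ht : (t : ℝ) = 0) : mk y t = vertex := by
  obtain rfl : t = ⟨0, by simp⟩ := Subtype.ext ht
  exact Quot.sound (Rel.vertex y)

lemma eq_vertex_or (z : OpenCone L) :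
    z = vertex ∨ ∃ y, ∃ t : Set.Ico (0 : ℝ) 1, 0 < (t : ℝ) ∧ z = mk y t := by
  induction z using Quot.ind with | _ z
  rcases z with _ | ⟨y, t⟩
  · exact Or.inl rfl
  · rcases t.2.1.eq_or_lt with h | h
    · exact Or.inl (mk_zero y h.symm)
    · exact Or.inr ⟨y, t, h, rfl⟩

lemma mk_mem_subcone {A : Set L} {y : L} {t : Set.Ico (0 : ℝ) 1} (ht : 0 < (t : ℝ)) :
    mk y t ∈ subcone A ↔ y ∈ A := by
  constructor
  · rintro (h | ⟨y', hy', t', h⟩)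
    · have := congr_arg coord h
      rw [coord_mk y ht] at this
      simp at this
    · have h1 := congr_arg height h
      have h2 := congr_arg coord h
      simp only [height_mk] at h1
      rw [coord_mk y ht, coord_mk y' (h1 ▸ ht)] at h2
      simp only [Option.some.injEq, Prod.mk.injEq] at h2
      rw [h2.1]; exact hy'
  · exact fun h ↦ Or.inr ⟨y, h, t, rfl⟩

lemma vertex_mem_subcone (A : Set L) : vertex ∈ subcone A := Or.inl rfl

variable [TopologicalSpace L]

lemma continuous_height : Continuous (height : OpenCone L → ℝ) :=
  continuous_quot_lift _ (by fun_prop)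

/-- The parametrization of the complement of the vertex. -/
def mkIoo (z : L × Set.Ioo (0 : ℝ) 1) : OpenCone L := mk z.1 ⟨z.2, z.2.2.1.le, z.2.2.2⟩

lemma isOpenEmbedding_mkIoo : Topology.IsOpenEmbedding (mkIoo (L := L)) := by
  have hc : Continuous (fun z : L × Set.Ioo (0 : ℝ) 1 ↦
      (z.1, (⟨z.2, z.2.2.1.le, z.2.2.2⟩ : Set.Ico (0 : ℝ) 1))) := by fun_prop
  refine .of_continuous_injective_isOpenMap ?_ ?_ ?_
  · exact continuous_quot_mk.comp (continuous_inr.comp hc)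
  · rintro ⟨y, t⟩ ⟨y', t'⟩ h
    have := congr_arg coord h
    rw [mkIoo, mkIoo, coord_mk _ t.2.1, coord_mk _ t'.2.1] at this
    simp only [Option.some.injEq, Prod.mk.injEq] at this
    exact Prod.ext this.1 (Subtype.ext this.2)
  · intro A hA
    refine (isQuotientMap_quot_mk (r := Rel L)).isOpen_preimage.1 ?_
    let e : L × Set.Ioo (0 : ℝ) 1 → L × Set.Ico (0 : ℝ) 1 :=
      Prod.map id (Set.inclusion Set.Ioo_subset_Ico_self)
    have he : Topology.IsOpenEmbedding e := by
      refine Topology.IsOpenEmbedding.prodMap .id ⟨.inclusion _, ?_⟩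
      rw [Set.range_inclusion]
      convert (isOpen_Ioi (a := (0 : ℝ))).preimage
        (continuous_subtype_val (p := fun x ↦ x ∈ Set.Ico (0 : ℝ) 1)) using 1
      ext x
      exact ⟨fun h ↦ h.1, fun h ↦ ⟨h, x.2.2⟩⟩
    convert isOpenMap_inr _ (he.isOpenMap A hA) using 1
    ext x
    constructor
    · rintro ⟨⟨y, t⟩, hz, hx⟩
      have h2 := congr_arg coord hx
      rw [mkIoo, coord_mk _ t.2.1] at h2
      rcases x with _ | ⟨y', t'⟩
      · exact absurd h2 (by simp [coord])
      · refine ⟨e (y, t), ⟨(y, t), hz, rfl⟩, ?_⟩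
        by_cases ht' : (t' : ℝ) = 0
        · simp only [coord, Sum.elim_inr, if_pos ht'] at h2
          cases h2
        · simp only [coord, Sum.elim_inr, if_neg ht', Option.some.injEq, Prod.mk.injEq] at h2
          obtain ⟨rfl, h2⟩ := h2
          exact congr_arg Sum.inr (Prod.ext rfl (Subtype.ext h2))
    · rintro ⟨_, ⟨z, hz, rfl⟩, rfl⟩
      exact ⟨z, hz, rfl⟩

/-- The sets of points of small height are a neighbourhood basis of the vertex. -/
lemma exists_height_lt_subset [CompactSpace L] {O : Set (OpenCone L)} (hO : IsOpen O)
    (hv : vertex ∈ O) : ∃ ε, 0 < ε ∧ ε ≤ 1 ∧ {z : OpenCone L | z.height < ε} ⊆ O := by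
  let f : L × Set.Ico (0 : ℝ) 1 → OpenCone L := fun z ↦ mk z.1 z.2
  have hf : Continuous f := continuous_quot_mk.comp continuous_inr
  -- Compactness of L gives a height that works for all y at once.
  obtain ⟨U, V, -, hV, hU, h0, hUV⟩ := generalized_tube_lemma (isCompact_univ (X := L))
    (isCompact_singleton (x := (⟨0, by simp⟩ : Set.Ico (0 : ℝ) 1))) (hO.preimage hf) (by
      rintro ⟨y, t⟩ ⟨-, ht⟩
      obtain rfl : t = ⟨0, by simp⟩ := ht
      have : f (y, ⟨0, by simp⟩) = vertex := mk_zero y rfl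
      rwa [Set.mem_preimage, this])
  obtain ⟨ε, hε, hεV⟩ := Metric.isOpen_iff.1 hV _ (h0 rfl)
  refine ⟨min ε 1, by positivity, min_le_right _ _, fun z hz ↦ ?_⟩
  rcases z.eq_vertex_or with rfl | ⟨y, t, ht, rfl⟩
  · exact hv
  · refine hUV (show (y, t) ∈ U ×ˢ V from ⟨hU trivial, hεV ?_⟩)
    rw [Metric.mem_ball, Subtype.dist_eq, Real.dist_eq, sub_zero, abs_of_pos ht]
    exact (show (t : ℝ) < min ε 1 from hz).trans_le (min_le_left _ _)

end OpenCone

section Charts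

variable {X L : Type u} [TopologicalSpace X] [TopologicalSpace L]

/-- Distinguished neighbourhoods of a point in the image of the cone points, and the structure of
their regular parts. -/
lemma IsDistinguishedChart.exists_nhds [CompactSpace L] {F : ℤ → Set X} {G : ℤ → Set L} {a : ℕ}
    {φ : EuclideanSpace ℝ (Fin a) × OpenCone L → X} (hφ : IsDistinguishedChart F G a φ)
    (hG : G (-1) = ∅) (j : ℤ) (hj : -1 ≤ j) (hGj : IsClosed (G j)) {x : X} (hx : x ∈ F a)
    (hxφ : x ∈ Set.range φ) {W : Set X} (hW : IsOpen W) (hxW : x ∈ W) :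
    ∃ N, IsOpen N ∧ x ∈ N ∧ N ⊆ W ∧
      ∃ ψ : ((G j)ᶜ : Set L) × (EuclideanSpace ℝ (Fin a) × ℝ) → X,
        Topology.IsOpenEmbedding ψ ∧ Set.range ψ = N \ F (a + j + 1) := by
  obtain ⟨hφo, hφF⟩ := hφ
  -- The case j = -1 of the chart condition, with G (-1) empty, places x on ℝᵃ × {vertex}.
  have h1 := hφF (-1) le_rfl
  rw [show (a : ℤ) + -1 + 1 = a by ring] at h1
  obtain ⟨⟨v, z⟩, hz, hvz⟩ : x ∈ φ '' {z | z.2 ∈ OpenCone.subcone (G (-1))} := h1 ▸ ⟨hxφ, hx⟩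
  obtain rfl : z = OpenCone.vertex := by
    rcases hz with hz | ⟨y, hy, -⟩
    · exact hz
    · simp [hG] at hy
  subst hvz
  obtain ⟨U, O, hU, hO, hvU, hvO, hUO⟩ := isOpen_prod_iff.1 (hW.preimage hφo.continuous) _ _ hxW
  obtain ⟨r, hr, hrU⟩ := Metric.isOpen_iff.1 hU v hvU
  obtain ⟨ε, hε, hε1, hεO⟩ := OpenCone.exists_height_lt_subset hO hvO
  obtain ⟨β, hβ, hβr⟩ := exists_isOpenEmbedding_ball v hr
  obtain ⟨σ, hσ, hσr⟩ := exists_isOpenEmbedding_ball (ε / 2) (half_pos hε)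
  -- The ball of radius ε / 2 about ε / 2 is (0, ε): σ parametrizes the cone coordinate away from
  -- the vertex by ℝ.
  have hσr' : Set.range σ = Set.Ioo 0 ε := by rw [hσr, Real.ball_eq_Ioo, sub_self, add_halves]
  have hσ1 : ∀ s, σ s ∈ Set.Ioo (0 : ℝ) 1 := fun s ↦ by
    have : σ s ∈ Set.Ioo 0 ε := hσr' ▸ Set.mem_range_self s
    exact ⟨this.1, this.2.trans_le hε1⟩
  have hσ' : Topology.IsOpenEmbedding (Set.codRestrict σ (Set.Ioo (0 : ℝ) 1) hσ1) :=
    .of_comp _ isOpen_Ioo.isOpenEmbedding_subtypeVal hσ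
  let N : Set X := φ '' (Metric.ball v r ×ˢ {z | z.height < ε})
  refine ⟨N, hφo.isOpenMap _ (Metric.isOpen_ball.prod
    (isOpen_Iio.preimage OpenCone.continuous_height)),
    ⟨_, ⟨Metric.mem_ball_self hr, by simpa using hε⟩, rfl⟩, ?_, ?_⟩
  · rintro _ ⟨⟨w, z⟩, ⟨hw, hz⟩, rfl⟩
    exact hUO ⟨hrU hw, hεO hz⟩
  let ψ₁ : ((G j)ᶜ : Set L) × (EuclideanSpace ℝ (Fin a) × ℝ) →
      EuclideanSpace ℝ (Fin a) × (L × Set.Ioo (0 : ℝ) 1) :=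
    fun z ↦ (β z.2.1, (z.1, Set.codRestrict σ (Set.Ioo (0 : ℝ) 1) hσ1 z.2.2))
  have hψ₁ : Topology.IsOpenEmbedding ψ₁ := by
    let e : ((G j)ᶜ : Set L) × (EuclideanSpace ℝ (Fin a) × ℝ) ≃ₜ
        EuclideanSpace ℝ (Fin a) × (((G j)ᶜ : Set L) × ℝ) :=
      { toFun := fun z ↦ (z.2.1, (z.1, z.2.2))
        invFun := fun z ↦ (z.2.1, (z.1, z.2.2))
        left_inv := fun _ ↦ rfl
        right_inv := fun _ ↦ rfl
        continuous_toFun := by fun_prop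
        continuous_invFun := by fun_prop }
    exact (hβ.prodMap (hGj.isOpen_compl.isOpenEmbedding_subtypeVal.prodMap hσ')).comp
      e.isOpenEmbedding
  refine ⟨φ ∘ Prod.map id OpenCone.mkIoo ∘ ψ₁, hφo.comp
    ((Topology.IsOpenEmbedding.id.prodMap OpenCone.isOpenEmbedding_mkIoo).comp hψ₁), ?_⟩
  have hmem : ∀ z, φ z ∈ F (a + j + 1) ↔ z.2 ∈ OpenCone.subcone (G j) := fun z ↦ by
    constructor
    · intro h
      obtain ⟨z', hz', e⟩ : φ z ∈ φ '' {z | z.2 ∈ OpenCone.subcone (G j)} :=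
        hφF j hj ▸ ⟨⟨z, rfl⟩, h⟩
      rwa [← hφo.injective e]
    · intro h
      have : φ z ∈ φ '' {z | z.2 ∈ OpenCone.subcone (G j)} := ⟨z, h, rfl⟩
      exact (hφF j hj ▸ this).2
  apply Set.Subset.antisymm
  · rintro _ ⟨⟨y, w, s⟩, rfl⟩
    have hs : σ s ∈ Set.Ioo 0 ε := hσr' ▸ Set.mem_range_self s
    refine ⟨⟨_, ⟨?_, ?_⟩, rfl⟩, ?_⟩
    · exact hβr ▸ Set.mem_range_self w
    · exact hs.2
    · rw [Function.comp_apply, hmem]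
      exact fun h ↦ y.2 ((OpenCone.mk_mem_subcone hs.1).1 h)
  · rintro _ ⟨⟨⟨w, z⟩, ⟨hw, hz⟩, rfl⟩, hF⟩
    rw [hmem] at hF
    rcases z.eq_vertex_or with rfl | ⟨y, t, ht, rfl⟩
    · exact absurd (OpenCone.vertex_mem_subcone _) hF
    · rw [OpenCone.mk_mem_subcone ht] at hF
      obtain ⟨w', rfl⟩ : w ∈ Set.range β := hβr ▸ hw
      obtain ⟨s, hs⟩ : (t : ℝ) ∈ Set.range σ := hσr' ▸ ⟨ht, hz⟩
      refine ⟨(⟨y, hF⟩, w', s), ?_⟩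
      have : (⟨σ s, (hσ1 s).1.le, (hσ1 s).2⟩ : Set.Ico (0 : ℝ) 1) = t := Subtype.ext hs
      simp [ψ₁, OpenCone.mkIoo, this]

end Charts

/-! ### Local structure of stratified spaces -/

namespace IsTopologicalStratification

variable {n : ℕ} {X : Type u} [TopologicalSpace X] {F : ℤ → Set X}

section Basic

variable (h : IsTopologicalStratification n X F)
include h

lemma t2Space : T2Space X := by
  rw [IsTopologicalStratification] at h; exact h.1

lemma mono : Monotone F := by
  rw [IsTopologicalStratification] at h; exact h.2.2.2.1

lemma isClosed (i : ℤ) : IsClosed (F i) := by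
  rw [IsTopologicalStratification] at h; exact h.2.2.2.2.1 i

lemma eq_empty {i : ℤ} (hi : i < 0) : F i = ∅ := by
  rw [IsTopologicalStratification] at h; exact h.2.2.2.2.2.1 i hi

lemma eq_univ {i : ℤ} (hi : n ≤ i) : F i = Set.univ := by
  rw [IsTopologicalStratification] at h; exact h.2.2.2.2.2.2.1 i hi

/-- Every point lies in a stratum. -/
lemma exists_stratum (x : X) :
    ∃ k : ℕ, k ≤ n ∧ x ∈ F (n - k) ∧ x ∉ F (n - k - 1) := by
  have key : ∀ l : ℕ, x ∉ F ((n : ℤ) - l) → ∃ k : ℕ, k < l ∧ x ∈ F (n - k) ∧ x ∉ F (n - k - 1) := by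
    intro l
    induction l with
    | zero => intro hx; simp [h.eq_univ (i := n) le_rfl] at hx
    | succ l ih =>
      intro hx
      by_cases hl : x ∈ F (n - l)
      · exact ⟨l, by lia, hl, by rwa [show (n : ℤ) - l - 1 = n - (l + 1 : ℕ) by lia]⟩
      · obtain ⟨k, hk, h'⟩ := ih hl
        exact ⟨k, by lia, h'⟩
  obtain ⟨k, hk, h'⟩ := key (n + 1) (by rw [h.eq_empty (by push_cast; lia)]; simp)
  exact ⟨k, by lia, h'⟩

/-- The structure of `X` near a singular point. -/
lemma exists_link {k : ℕ} (hk : k + 1 ≤ n) {x : X} (hx : x ∈ F (n - (k + 1 : ℕ)))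
    (hx' : x ∉ F (n - (k + 1 : ℕ) - 1)) :
    ∃ (L : Type u) (_ : TopologicalSpace L) (G : ℤ → Set L),
      CompactSpace L ∧ IsTopologicalStratification k L G ∧ ∃ a : ℕ, ∀ W, IsOpen W → x ∈ W →
        ∃ N, IsOpen N ∧ x ∈ N ∧ N ⊆ W ∧
          ∃ ψ : ((G (k - 1))ᶜ : Set L) × (EuclideanSpace ℝ (Fin a) × ℝ) → X,
            Topology.IsOpenEmbedding ψ ∧ Set.range ψ = N \ F (n - 1) := by
  rw [IsTopologicalStratification] at h
  obtain ⟨L, hL, G, hc, -, hG, φ, hφ, hxφ⟩ := h.2.2.2.2.2.2.2 (k + 1) hk x hx hx'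
  replace hG : IsTopologicalStratification k L G := hG
  have e : ((n - (k + 1) : ℕ) : ℤ) = n - (k + 1 : ℕ) := by lia
  refine ⟨L, hL, G, hc, hG, n - (k + 1), fun W hW hxW ↦ ?_⟩
  -- The link has dimension k, so G (k - 1) is its singular set, and a + (k - 1) + 1 = n - 1 for a =
  -- n - (k + 1).
  obtain ⟨N, h1, h2, h3, ψ, h4, h5⟩ := hφ.exists_nhds (hG.eq_empty (by lia)) (k - 1) (by lia)
    (hG.isClosed _) (by rwa [e]) hxφ hW hxW
  refine ⟨N, h1, h2, h3, ψ, h4, ?_⟩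
  rw [h5, e, show (n : ℤ) - (k + 1 : ℕ) + (k - 1) + 1 = n - 1 by lia]

/-- The top stratum is a manifold. -/
lemma exists_chart {x : X} (hx : x ∉ F (n - 1)) :
    ∃ c : (Fin n → ℝ) → ((F (n - 1))ᶜ : Set X),
      Topology.IsOpenEmbedding c ∧ ⟨x, hx⟩ ∈ Set.range c := by
  have hcl := h.isClosed (n - 1)
  have hu := h.eq_univ (i := n) le_rfl
  rw [IsTopologicalStratification] at h
  obtain ⟨L, hL, G, -, -, hG, φ, hφ, hxφ⟩ := h.2.2.2.2.2.2.2 0 (Nat.zero_le n) x (by simp [hu])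
    (by simpa using hx)
  replace hG : IsEmpty L := hG
  have hv : ∀ z : OpenCone L, z = OpenCone.vertex := fun z ↦ by
    rcases z.eq_vertex_or with h | ⟨y, -⟩
    exacts [h, isEmptyElim y]
  let e : EuclideanSpace ℝ (Fin n) ≃ₜ EuclideanSpace ℝ (Fin n) × OpenCone L :=
    { toFun := fun v ↦ (v, OpenCone.vertex)
      invFun := fun z ↦ z.1
      left_inv := fun _ ↦ rfl
      right_inv := fun z ↦ Prod.ext rfl (hv z.2).symm
      continuous_toFun := by fun_prop
      continuous_invFun := by fun_prop }
  have hc : Topology.IsOpenEmbedding (φ ∘ e) := hφ.1.comp e.isOpenEmbedding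
  obtain ⟨z, rfl⟩ := hxφ
  obtain ⟨v, rfl⟩ := e.surjective z
  obtain ⟨r, hr, hrv⟩ := Metric.isOpen_iff.1 (hcl.isOpen_compl.preimage hc.continuous) v hx
  obtain ⟨β, hβ, hβr⟩ := exists_isOpenEmbedding_ball v hr
  have hmem : ∀ w, (φ ∘ e) (β w) ∈ (F (n - 1))ᶜ := fun w ↦ hrv (hβr ▸ Set.mem_range_self w)
  have hcβ : Topology.IsOpenEmbedding (Set.codRestrict ((φ ∘ e) ∘ β) (F (n - 1))ᶜ hmem) :=
    .of_comp _ hcl.isOpen_compl.isOpenEmbedding_subtypeVal (hc.comp hβ)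
  refine ⟨_, hcβ.comp (EuclideanSpace.equiv (Fin n) ℝ).toHomeomorph.symm.isOpenEmbedding, ?_⟩
  obtain ⟨w, hw⟩ : v ∈ Set.range β := hβr ▸ Metric.mem_ball_self hr
  refine ⟨EuclideanSpace.equiv (Fin n) ℝ w, Subtype.ext ?_⟩
  change φ (e (β ((EuclideanSpace.equiv (Fin n) ℝ).symm (EuclideanSpace.equiv (Fin n) ℝ w)))) = _
  rw [ContinuousLinearEquiv.symm_apply_apply, hw]

end Basic

/-- The top stratum of a compact stratified space is `σ`-compact. -/
theorem sigmaCompactSpace (h : IsTopologicalStratification n X F) [CompactSpace X] :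
    SigmaCompactSpace ((F (n - 1))ᶜ : Set X) := by
  induction n using Nat.strong_induction_on generalizing X with | _ n ih
  have := h.t2Space
  -- Regular points have compact neighbourhoods in the top stratum. At singular points the regular
  -- part of N is the top stratum of a compact link of smaller dimension times a vector space, so
  -- induction applies.
  have key : ∀ x : X, ∃ N, IsOpen N ∧ x ∈ N ∧
      ∃ S, IsSigmaCompact S ∧ N \ F (n - 1) ⊆ S ∧ S ⊆ (F (n - 1))ᶜ := by
    intro x
    obtain ⟨k, hk, hx, hx'⟩ := h.exists_stratum x
    rcases k with _ | k
    · obtain ⟨K, hK, hxK, hKF⟩ := exists_compact_subset (h.isClosed (n - 1)).isOpen_compl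
        (show x ∈ (F (n - 1))ᶜ by simpa using hx')
      exact ⟨interior K, isOpen_interior, hxK, K, hK.isSigmaCompact,
        Set.sdiff_subset.trans interior_subset, hKF⟩
    · obtain ⟨L, _, G, _, hG, a, hN⟩ := h.exists_link hk hx hx'
      obtain ⟨N, h1, h2, -, ψ, h4, h5⟩ := hN Set.univ isOpen_univ trivial
      have := ih k hk hG
      exact ⟨N, h1, h2, Set.range ψ, isSigmaCompact_range h4.continuous, h5.ge,
        h5.le.trans fun y hy ↦ hy.2⟩
  choose N hNo hxN S hS hNS hSF using key
  obtain ⟨T, hT⟩ := isCompact_univ.elim_finite_subcover N hNo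
    fun x _ ↦ Set.mem_iUnion.2 ⟨x, hxN x⟩
  rw [← isSigmaCompact_iff_sigmaCompactSpace]
  have e : (F (n - 1))ᶜ = ⋃ x ∈ T, S x := by
    refine Set.Subset.antisymm (fun y hy ↦ ?_) (Set.iUnion₂_subset fun x _ ↦ hSF x)
    obtain ⟨x, hx, hyx⟩ := Set.mem_iUnion₂.1 (hT (Set.mem_univ y))
    exact Set.mem_iUnion₂.2 ⟨x, hx, hNS x ⟨hyx, hy⟩⟩
  rw [e]
  exact isSigmaCompact_biUnion T.countable_toSet fun x _ ↦ hS x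

end IsTopologicalStratification

/-! ### Right derived functors and morphisms with cone in degrees ≥ m -/

section Derived

open Limits Pretriangulated Triangulated ZeroObject

namespace CategoryTheory.Functor

variable {A B E : Type*} [Category* A] [Category* B] [Category* E] [Abelian A] [Abelian B]
  [Abelian E] [HasDerivedCategory A] [HasDerivedCategory B] [HasDerivedCategory E]

lemma exists_isGE (K : DerivedCategory.Plus A) : ∃ m : ℤ, K.IsGE m := by
  obtain ⟨m, hm⟩ := K.property
  exact ⟨m, (DerivedCategory.Plus.isGE_ι_obj_iff K m).1 hm⟩

lemma isGE_Qh_obj (I : HomotopyCategory.Plus A) (m : ℤ) [CochainComplex.IsGE I.obj.as m] :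
    (DerivedCategory.Plus.Qh.obj I).IsGE m := by
  rw [← DerivedCategory.Plus.isGE_ι_obj_iff]
  exact DerivedCategory.TStructure.t.isGE_of_iso
    ((DerivedCategory.quotientCompQhIso A).symm.app I.obj.as) m

variable [EnoughInjectives A]

/-- The derived functor is computed by complexes of injective objects. -/
noncomputable def rightDerivedFunctorPlusObjIso (F : A ⥤ B) [F.Additive]
    (K : HomotopyCategory.Plus A) [∀ n, Injective (K.obj.as.X n)] :
    F.rightDerivedFunctorPlus.obj (DerivedCategory.Plus.Qh.obj K) ≅
      DerivedCategory.Plus.Qh.obj (F.mapHomotopyCategoryPlus.obj K) :=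
  (asIso (F.rightDerivedFunctorPlusUnit.app K)).symm

lemma exists_injective_iso (K : DerivedCategory.Plus A) (m : ℤ) [K.IsGE m] :
    ∃ I : HomotopyCategory.Plus A, (∀ n, Injective (I.obj.as.X n)) ∧
      CochainComplex.IsStrictlyGE I.obj.as m ∧ Nonempty (DerivedCategory.Plus.Qh.obj I ≅ K) := by
  obtain ⟨L, hL, ⟨e⟩⟩ := DerivedCategory.Plus.exists_injective_nonempty_iso K m
  refine ⟨(HomotopyCategory.Plus.quotient A).obj ((InjectiveObject.ι A).mapCochainComplexPlus.obj L),
    inferInstance, ?_, ⟨e⟩⟩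
  exact inferInstanceAs (CochainComplex.IsStrictlyGE
    (((InjectiveObject.ι A).mapHomologicalComplex _).obj L.obj) m)

/-- Right derived functors are left t-exact. -/
lemma isGE_rightDerivedFunctorPlus_obj (F : A ⥤ B) [F.Additive] (K : DerivedCategory.Plus A)
    (m : ℤ) [K.IsGE m] : (F.rightDerivedFunctorPlus.obj K).IsGE m := by
  obtain ⟨I, _, _, ⟨e⟩⟩ := exists_injective_iso K m
  have : CochainComplex.IsStrictlyGE (F.mapHomotopyCategoryPlus.obj I).obj.as m :=
    inferInstanceAs (CochainComplex.IsStrictlyGE ((F.mapHomologicalComplex _).obj I.obj.as) m)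
  have := isGE_Qh_obj (F.mapHomotopyCategoryPlus.obj I) m
  exact DerivedCategory.Plus.TStructure.t.isGE_of_iso
    ((F.rightDerivedFunctorPlusObjIso I).symm ≪≫ F.rightDerivedFunctorPlus.mapIso e) m

/-- The derived functor of a composition. -/
lemma nonempty_rightDerivedFunctorPlus_comp_iso [EnoughInjectives B] (F : A ⥤ B) (G : B ⥤ E)
    (H : A ⥤ E) [F.Additive] [G.Additive] [H.Additive] (e : F ⋙ G ≅ H)
    (hF : ∀ I : A, Injective I → Injective (F.obj I)) (K : DerivedCategory.Plus A) :
    Nonempty (G.rightDerivedFunctorPlus.obj (F.rightDerivedFunctorPlus.obj K) ≅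
      H.rightDerivedFunctorPlus.obj K) := by
  obtain ⟨m, _⟩ := exists_isGE K
  obtain ⟨I, hI, _, ⟨e'⟩⟩ := exists_injective_iso K m
  -- F carries the injective complex to an injective one, on which the derived functor of G can be
  -- computed directly.
  have : ∀ n, Injective ((F.mapHomotopyCategoryPlus.obj I).obj.as.X n) := fun n ↦ hF _ (hI n)
  exact ⟨G.rightDerivedFunctorPlus.mapIso (F.rightDerivedFunctorPlus.mapIso e'.symm ≪≫
      F.rightDerivedFunctorPlusObjIso I) ≪≫ G.rightDerivedFunctorPlusObjIso _ ≪≫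
    DerivedCategory.Plus.Qh.mapIso ((mapHomotopyCategoryPlusCompIso e).app I) ≪≫
    (H.rightDerivedFunctorPlusObjIso I).symm ≪≫ H.rightDerivedFunctorPlus.mapIso e'⟩

/-- The derived functor of the identity. -/
lemma nonempty_rightDerivedFunctorPlus_id_iso (F : A ⥤ A) [F.Additive] (e : F ≅ 𝟭 A)
    (K : DerivedCategory.Plus A) :
    Nonempty (F.rightDerivedFunctorPlus.obj K ≅ K) := by
  obtain ⟨m, _⟩ := exists_isGE K
  obtain ⟨I, hI, _, ⟨e'⟩⟩ := exists_injective_iso K m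
  let i : F.mapHomotopyCategoryPlus.obj I ≅ I :=
    (HomotopyCategory.Plus.fullyFaithfulι A).preimageIso
      ((HomotopyCategory.quotient A (.up ℤ)).mapIso
        ((NatIso.mapHomologicalComplex e (.up ℤ)).app I.obj.as ≪≫
          (Functor.mapHomologicalComplexIdIso A (.up ℤ)).app I.obj.as))
  exact ⟨F.rightDerivedFunctorPlus.mapIso e'.symm ≪≫ F.rightDerivedFunctorPlusObjIso I ≪≫
    DerivedCategory.Plus.Qh.mapIso i ≪≫ e'⟩

end CategoryTheory.Functor

namespace DerivedCategory.Plus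

variable {A : Type*} [Category* A] [Abelian A] [HasDerivedCategory A]

/-- The cone of `f` is concentrated in degrees `≥ m`. -/
def HasConeGE {K L : DerivedCategory.Plus A} (f : K ⟶ L) (m : ℤ) : Prop :=
  ∃ (C : DerivedCategory.Plus A) (g : L ⟶ C) (h : C ⟶ K⟦(1 : ℤ)⟧),
    Triangle.mk f g h ∈ distTriang (DerivedCategory.Plus A) ∧ C.IsGE m

namespace HasConeGE

variable {K L M : DerivedCategory.Plus A} {m : ℤ}

lemma of_isIso (f : K ⟶ L) [IsIso f] (m : ℤ) : HasConeGE f m :=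
  ⟨0, 0, 0, isomorphic_distinguished _ (contractible_distinguished K) _
    (Triangle.isoMk _ _ (Iso.refl _) (asIso f).symm (Iso.refl _)
      ((IsIso.hom_inv_id f).trans (Category.id_comp _).symm)
      (zero_comp.trans comp_zero.symm) (zero_comp.trans comp_zero.symm)), inferInstance⟩

/-- By the octahedral axiom the cone of the composite is an extension of the two cones. -/
lemma comp {f : K ⟶ L} {g : L ⟶ M} (hf : HasConeGE f m) (hg : HasConeGE g m) :
    HasConeGE (f ≫ g) m := by
  obtain ⟨C₁, g₁, h₁, hT₁, hC₁⟩ := hf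
  obtain ⟨C₂, g₂, h₂, hT₂, hC₂⟩ := hg
  obtain ⟨C, g', h', hT⟩ := distinguished_cocone_triangle (f ≫ g)
  exact ⟨C, g', h', hT, TStructure.t.isGE₂ _ (someOctahedron rfl hT₁ hT₂ hT).mem m hC₁ hC₂⟩

lemma of_triangle (T : Triangle (DerivedCategory.Plus A))
    (hT : T ∈ distTriang (DerivedCategory.Plus A)) (h : T.obj₃.IsGE m) : HasConeGE T.mor₁ m :=
  ⟨_, _, _, hT, h⟩

/-- In the long exact sequence, vanishing of the cone in degree j - 1 gives injectivity and
vanishing in degree j gives surjectivity. -/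
lemma isIso_homology {f : K ⟶ L} (hf : HasConeGE f m) (j : ℤ) (hj : j < m) :
    IsIso ((homologyFunctor A j).map f) := by
  obtain ⟨C, g, h, hT, hC⟩ := hf
  have hT' := Plus.ι.map_distinguished _ hT
  have h0 : ∀ i, i < m → IsZero ((DerivedCategory.homologyFunctor A i).obj (ι.obj C)) :=
    fun i hi ↦ isZero_homology_of_isGE C m i hi
  have hm : Mono ((DerivedCategory.homologyFunctor A j).map (ι.map f)) :=
    (DerivedCategory.HomologySequence.mono_homologyMap_mor₁_iff _ hT' (j - 1) j (by lia)).2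
      ((h0 (j - 1) (by lia)).eq_of_src _ _)
  have he : Epi ((DerivedCategory.homologyFunctor A j).map (ι.map f)) :=
    (DerivedCategory.HomologySequence.epi_homologyMap_mor₁_iff _ hT' j).2
      ((h0 j hj).eq_of_tgt _ _)
  have : IsIso ((DerivedCategory.homologyFunctor A j).map (ι.map f)) := isIso_of_mono_of_epi _
  exact this

/-- Derived functors preserve morphisms whose cone is concentrated in degrees `≥ m`. -/
lemma rightDerivedFunctorPlus_map {B : Type*} [Category* B] [Abelian B] [HasDerivedCategory B]
    [EnoughInjectives A] (F : A ⥤ B) [F.Additive] {f : K ⟶ L} (hf : HasConeGE f m) :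
    HasConeGE (F.rightDerivedFunctorPlus.map f) m := by
  let Φ : HomotopyCategory.Plus (InjectiveObject A) ⥤ HomotopyCategory.Plus A :=
    (InjectiveObject.ι A).mapHomotopyCategoryPlus
  let I := (Φ ⋙ Qh).objPreimage K
  let J := (Φ ⋙ Qh).objPreimage L
  let eK : Qh.obj (Φ.obj I) ≅ K := (Φ ⋙ Qh).objObjPreimageIso K
  let eL : Qh.obj (Φ.obj J) ≅ L := (Φ ⋙ Qh).objObjPreimageIso L
  -- Between bounded below complexes of injectives f is represented by a homotopy class φ, whose
  -- cone T₃ is again a complex of injectives.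
  obtain ⟨φ, hφ⟩ := (Qh_map_bijective_of_isKInjective (Φ.obj I) (Φ.obj J) (by
    obtain ⟨n, hn⟩ := (HomotopyCategory.plus_quotient_obj_iff (Φ.obj J).obj.as).1 (Φ.obj J).property
    have : CochainComplex.IsStrictlyGE (Φ.obj J).obj.as n := hn
    have (i : ℤ) : Injective ((Φ.obj J).obj.as.X i) :=
      inferInstanceAs (Injective ((InjectiveObject.ι A).obj (J.obj.as.X i)))
    exact CochainComplex.isKInjective_of_injective _ n)).2 (eK.hom ≫ f ≫ eL.inv)
  obtain ⟨φ, rfl⟩ := Φ.map_surjective φ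
  obtain ⟨T₃, g, h, hT⟩ := distinguished_cocone_triangle φ
  have hT₁ := Qh.map_distinguished _ (Φ.map_distinguished _ hT)
  obtain ⟨C, g', h', hT', hC⟩ := hf
  have i : Qh.obj (Φ.obj T₃) ≅ C := Triangle.π₃.mapIso
    (isoTriangleOfIso₁₂ _ _ hT₁ hT' eK eL (by
      change Qh.map (Φ.map φ) ≫ eL.hom = eK.hom ≫ f
      rw [hφ]; simp))
  have hGE : (Qh.obj (Φ.obj T₃)).IsGE m := TStructure.t.isGE_of_iso i.symm m
  have hT₂ := Qh.map_distinguished _ (F.mapHomotopyCategoryPlus.map_distinguished _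
    (Φ.map_distinguished _ hT))
  -- Applying F termwise gives a triangle whose third vertex computes RF of the cone, hence lies in
  -- degrees ≥ m by left t-exactness.
  have key : HasConeGE (Qh.map (F.mapHomotopyCategoryPlus.map (Φ.map φ))) m := by
    refine of_triangle _ hT₂ ?_
    have := F.isGE_rightDerivedFunctorPlus_obj (Qh.obj (Φ.obj T₃)) m
    exact TStructure.t.isGE_of_iso (F.rightDerivedFunctorPlusObjIso (Φ.obj T₃)) m
  have e : F.rightDerivedFunctorPlus.map f = (F.rightDerivedFunctorPlus.map eK.inv ≫
      (F.rightDerivedFunctorPlusObjIso (Φ.obj I)).hom) ≫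
      Qh.map (F.mapHomotopyCategoryPlus.map (Φ.map φ)) ≫
      (F.rightDerivedFunctorPlusObjIso (Φ.obj J)).inv ≫ F.rightDerivedFunctorPlus.map eL.hom := by
    have hn := F.rightDerivedFunctorPlusUnit.naturality (Φ.map φ)
    have hn' : Qh.map (F.mapHomotopyCategoryPlus.map (Φ.map φ)) ≫
        (F.rightDerivedFunctorPlusObjIso (Φ.obj J)).inv =
        (F.rightDerivedFunctorPlusObjIso (Φ.obj I)).inv ≫
          F.rightDerivedFunctorPlus.map (Qh.map (Φ.map φ)) := hn
    rw [reassoc_of% hn', Category.assoc, Iso.hom_inv_id_assoc, hφ, ← Functor.map_comp,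
      ← Functor.map_comp]
    simp
  rw [e]
  exact (of_isIso _ m).comp (key.comp (of_isIso _ m))

end HasConeGE

end DerivedCategory.Plus

end Derived

/-! ### Sections of sheaves of modules; injective sheaves are flasque -/

section Sheaves

open Limits

/-- The restriction maps of an injective sheaf along monomorphisms have sections. -/
lemma CategoryTheory.Sheaf.exists_comp_map_eq_id {C : Type u} [Category.{v} C]
    (J : GrothendieckTopology C) {A : Type*} [Category* A] [Abelian A] [HasCoproducts.{v} A]
    [HasSheafify J A] (I : Sheaf J A) [Injective I] {V U : C} (i : V ⟶ U) [Mono i] :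
    ∃ g : I.obj.obj (op V) ⟶ I.obj.obj (op U), g ≫ I.obj.map i.op = 𝟙 _ := by
  let M : A := I.obj.obj (op V)
  -- The free presheaf on V with value M = I(V) embeds in the one on U. Injectivity of I extends the
  -- map corresponding to the identity of M, and the extension is a map I(V) → I(U) splitting the
  -- restriction.
  let α : Presheaf.freeYoneda V M ⟶ Presheaf.freeYoneda U M :=
    { app W := Sigma.map' (fun k : W.unop ⟶ V ↦ k ≫ i) (fun _ ↦ 𝟙 M)
      naturality W W' f := by
        refine Eq.trans (Sigma.map'_comp_map' _ _ _ _) (Eq.trans ?_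
          (Sigma.map'_comp_map' _ _ _ _).symm)
        congr 1
        ext k
        exact Category.assoc _ _ _ }
  have hα (W : Cᵒᵖ) : Mono (α.app W) :=
    MonoCoprod.mono_map'_of_injective (fun _ : W.unop ⟶ U ↦ M) _ fun k l h ↦ (cancel_mono i).1 h
  have : Mono α := NatTrans.mono_of_mono_app _
  have : Mono ((presheafToSheaf J A).map α) := inferInstance
  let β : (presheafToSheaf J A).obj (Presheaf.freeYoneda V M) ⟶ I :=
    ((sheafificationAdjunction J A).homEquiv _ _).symm (Presheaf.freeYonedaHomEquiv.symm (𝟙 M))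
  let γ := (sheafificationAdjunction J A).homEquiv _ _
    (Injective.factorThru β ((presheafToSheaf J A).map α))
  have hγ : α ≫ γ = Presheaf.freeYonedaHomEquiv.symm (𝟙 M) := by
    rw [← Adjunction.homEquiv_naturality_left, Injective.comp_factorThru,
      Equiv.apply_symm_apply]
  let g : M ⟶ I.obj.obj (op U) := Presheaf.freeYonedaHomEquiv γ
  refine ⟨g, ?_⟩
  have e : Presheaf.freeYonedaHomEquiv (α ≫ γ) = 𝟙 M := by
    rw [hγ]; exact Equiv.apply_symm_apply _ _
  rw [← e]
  have h₁ : Sigma.ι (fun _ : V ⟶ V ↦ M) (𝟙 V) ≫ α.app (op V) =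
      Sigma.ι (fun _ : V ⟶ U ↦ M) i := by
    refine (Sigma.ι_comp_map' _ _ _).trans ?_
    simp
  have h₂ : Sigma.ι (fun _ : U ⟶ U ↦ M) (𝟙 U) ≫ (Presheaf.freeYoneda U M).map i.op =
      Sigma.ι (fun _ : V ⟶ U ↦ M) i := by
    refine (Sigma.ι_comp_map' _ _ _).trans ?_
    simp
  refine (Category.assoc _ _ _).trans ((congrArg _ (γ.naturality i.op).symm).trans ?_)
  refine ((Category.assoc _ _ _).symm.trans (congrArg (· ≫ γ.app (op V)) (h₂.trans h₁.symm))).trans ?_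
  exact Category.assoc _ _ _

namespace ModSheaf

variable {R : Type u} [CommRing R] {Y Z : TopCat.{u}}

/-- Sections of a sheaf of modules. -/
abbrev Sec (F : ModSheaf R Y) (U : Opens Y) : Type u := F.obj.obj (op U)

/-- Restriction of sections. -/
def res (F : ModSheaf R Y) {U V : Opens Y} (h : V ≤ U) : Sec F U →ₗ[R] Sec F V :=
  (F.obj.map (homOfLE h).op).hom

/-- The action of a morphism on sections. -/
def app {F G : ModSheaf R Y} (f : F ⟶ G) (U : Opens Y) : Sec F U →ₗ[R] Sec G U :=
  (f.hom.app (op U)).hom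

@[simp]
lemma res_self (F : ModSheaf R Y) {U : Opens Y} (h : U ≤ U) (s : Sec F U) : res F h s = s :=
  ConcreteCategory.congr_hom (F.obj.map_id (op U)) s

@[simp]
lemma res_res (F : ModSheaf R Y) {U V W : Opens Y} (h : V ≤ U) (h' : W ≤ V) (s : Sec F U) :
    res F h' (res F h s) = res F (h'.trans h) s :=
  (ConcreteCategory.congr_hom (F.obj.map_comp (homOfLE h).op (homOfLE h').op) s).symm

lemma app_res {F G : ModSheaf R Y} (f : F ⟶ G) {U V : Opens Y} (h : V ≤ U) (s : Sec F U) :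
    app f V (res F h s) = res G h (app f U s) :=
  ConcreteCategory.congr_hom (f.hom.naturality (homOfLE h).op) s

lemma app_comp {F G H : ModSheaf R Y} (f : F ⟶ G) (g : G ⟶ H) {U : Opens Y} (s : Sec F U) :
    app (f ≫ g) U s = app g U (app f U s) := rfl

lemma app_zero {F G : ModSheaf R Y} {U : Opens Y} (s : Sec F U) :
    app (0 : F ⟶ G) U s = 0 := rfl

lemma eq_of_locally_eq (F : ModSheaf R Y) {U : Opens Y} {s t : Sec F U}
    (h : ∀ y ∈ U, ∃ (V : Opens Y) (hV : V ≤ U), y ∈ V ∧ res F hV s = res F hV t) : s = t := by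
  choose V hV hy e using h
  refine TopCat.Sheaf.eq_of_locally_eq' F (fun y : U ↦ V y y.2) U (fun y ↦ homOfLE (hV y y.2))
    (fun y hyU ↦ ?_) s t (fun y ↦ e y y.2)
  exact Opens.mem_iSup.2 ⟨⟨y, hyU⟩, hy y hyU⟩

lemma exists_glue (F : ModSheaf R Y) {ι : Type*} {U : ι → Opens Y} {V : Opens Y}
    (hU : ∀ i, U i ≤ V) (hV : V ≤ iSup U) (s : ∀ i, Sec F (U i))
    (hs : ∀ i j, res F (inf_le_left : U i ⊓ U j ≤ U i) (s i) = res F inf_le_right (s j)) :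
    ∃ t : Sec F V, ∀ i, res F (hU i) t = s i :=
  (TopCat.Sheaf.existsUnique_gluing' F U V (fun i ↦ homOfLE (hU i)) hV s hs).exists

/-- Exactness can be checked locally. -/
lemma exact_iff_locally (S : ShortComplex (ModSheaf R Y)) :
    S.Exact ↔ ∀ (U : Opens Y) (s : Sec S.X₂ U), app S.g U s = 0 → ∀ y ∈ U,
      ∃ (V : Opens Y) (hV : V ≤ U), y ∈ V ∧ ∃ t : Sec S.X₁ V, app S.f V t = res S.X₂ hV s := by
  rw [TopCat.Sheaf.exact_iff_stalkFunctor_map_exact]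
  simp only [ShortComplex.moduleCat_exact_iff]
  constructor
  · intro h U s hs y hy
    obtain ⟨t, ht⟩ := h y (TopCat.Presheaf.germ S.X₂.obj U y hy s) (by
      refine (TopCat.Presheaf.stalkFunctor_map_germ_apply U y hy S.g.hom s).trans ?_
      exact (congrArg (TopCat.Presheaf.germ S.X₃.obj U y hy) hs).trans (map_zero _))
    obtain ⟨V, hy', t, rfl⟩ := TopCat.Presheaf.exists_germ_eq S.X₁.obj t
    have ht' := (TopCat.Presheaf.stalkFunctor_map_germ_apply V y hy' S.f.hom t).symm.trans ht
    obtain ⟨W, hW, i, j, e⟩ := TopCat.Presheaf.germ_eq S.X₂.obj y hy' hy _ _ ht'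
    exact ⟨W, j.le, hW, res S.X₁ i.le t, (app_res S.f i.le t).trans e⟩
  · intro h y s hs
    obtain ⟨U, hy, s, rfl⟩ := TopCat.Presheaf.exists_germ_eq S.X₂.obj s
    have hs' := (TopCat.Presheaf.stalkFunctor_map_germ_apply U y hy S.g.hom s).symm.trans hs
    obtain ⟨W, hW, i, j, e⟩ := TopCat.Presheaf.germ_eq S.X₃.obj y hy hy _ 0
      (hs'.trans (map_zero _).symm)
    obtain ⟨V, hV, hyV, t, ht⟩ := h W (res S.X₂ i.le s)
      ((app_res S.g i.le s).trans (e.trans (map_zero _))) y hW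
    refine ⟨TopCat.Presheaf.germ S.X₁.obj V y hyV t, ?_⟩
    refine (TopCat.Presheaf.stalkFunctor_map_germ_apply V y hyV S.f.hom t).trans ?_
    refine (congrArg (TopCat.Presheaf.germ S.X₂.obj V y hyV) ht).trans ?_
    rw [res_res]
    exact TopCat.Presheaf.germ_res_apply S.X₂.obj (homOfLE (hV.trans i.le)) y hyV s

lemma app_injective {F G : ModSheaf R Y} (f : F ⟶ G) [Mono f] (U : Opens Y) :
    Function.Injective (app f U) := by
  have h : Mono ((TopCat.Sheaf.forget _ Y).map f) := inferInstance
  have : Mono (f.hom.app (op U)) :=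
    inferInstanceAs (Mono (((evaluation _ _).obj (op U)).map ((TopCat.Sheaf.forget _ Y).map f)))
  exact (ModuleCat.mono_iff_injective _).1 this

/-- Injective sheaves are flasque. -/
lemma res_surjective (I : ModSheaf R Y) [Injective I] {U V : Opens Y} (h : V ≤ U) :
    Function.Surjective (res I h) := by
  have : @Injective (Sheaf (Opens.grothendieckTopology Y) (ModuleCat.{u} R)) _ I := ‹_›
  obtain ⟨g, hg⟩ := Sheaf.exists_comp_map_eq_id (Opens.grothendieckTopology Y) I (homOfLE h)
  exact fun s ↦ ⟨g.hom s, ConcreteCategory.congr_hom hg s⟩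

/-- Direct image is right adjoint to the inverse image, which is left exact and so preserves
monomorphisms. -/
instance pushforward_obj_injective (f : Y ⟶ Z) (I : ModSheaf R Y) [Injective I] :
    Injective ((TopCat.Sheaf.pushforward (ModuleCat.{u} R) f).obj I) := by
  have : Limits.PreservesFiniteLimits (TopCat.Sheaf.pullback (ModuleCat.{u} R) f) :=
    Functor.sheafPullbackConstruction.preservesFiniteLimits (Opens.map f) (ModuleCat.{u} R)
      (Opens.grothendieckTopology Z) (Opens.grothendieckTopology Y)
  exact Injective.injective_of_adjoint
    (TopCat.Sheaf.pullbackPushforwardAdjunction (ModuleCat.{u} R) f) I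

end ModSheaf

end Sheaves

/-! ### Complexes on a product M × B regarded as complexes on M -/

section Tubes

open Topology

variable {Y : TopCat.{u}} {M : Type v} {B : Type w} [TopologicalSpace M] [TopologicalSpace B]
  {ψ : M × B → Y} (hψ : IsOpenEmbedding ψ)

/-- The image of `V × B` under an open embedding of `M × B`. -/
def Topology.IsOpenEmbedding.tube (V : Opens M) : Opens Y :=
  ⟨ψ '' ((V : Set M) ×ˢ Set.univ), hψ.isOpenMap _ (V.isOpen.prod isOpen_univ)⟩

namespace Topology.IsOpenEmbedding

lemma mem_tube {V : Opens M} {y : Y} : y ∈ hψ.tube V ↔ ∃ x b, x ∈ V ∧ ψ (x, b) = y := by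
  constructor
  · rintro ⟨⟨x, b⟩, ⟨hx, -⟩, rfl⟩
    exact ⟨x, b, hx, rfl⟩
  · rintro ⟨x, b, hx, rfl⟩
    exact ⟨(x, b), ⟨hx, trivial⟩, rfl⟩

lemma apply_mem_tube {V : Opens M} {x : M} {b : B} : ψ (x, b) ∈ hψ.tube V ↔ x ∈ V := by
  rw [mem_tube]
  constructor
  · rintro ⟨x', b', hx, e⟩
    obtain ⟨rfl, -⟩ := Prod.mk.inj (hψ.injective e)
    exact hx
  · exact fun hx ↦ ⟨x, b, hx, rfl⟩

lemma tube_mono {V V' : Opens M} (h : V ≤ V') : hψ.tube V ≤ hψ.tube V' :=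
  Set.image_mono (Set.prod_mono h subset_rfl)

lemma tube_le_top (V : Opens M) : hψ.tube V ≤ hψ.tube ⊤ := hψ.tube_mono le_top

lemma inf_tube_le (V V' : Opens M) : hψ.tube V ⊓ hψ.tube V' ≤ hψ.tube (V ⊓ V') := by
  rintro y ⟨h, h'⟩
  obtain ⟨x, b, hx, rfl⟩ := hψ.mem_tube.1 h
  exact hψ.apply_mem_tube.2 ⟨hx, hψ.apply_mem_tube.1 h'⟩

lemma mem_tube_top {y : Y} : y ∈ hψ.tube ⊤ ↔ y ∈ Set.range ψ := by
  simp [mem_tube]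

end Topology.IsOpenEmbedding

end Tubes

namespace ModSheaf

open Topology

variable {R : Type u} [CommRing R] {Y : TopCat.{u}}

/-- The complex of sections over `U` is exact. -/
def ExactOn (I : CochainComplex (ModSheaf R Y) ℤ) (i j k : ℤ) (U : Opens Y) : Prop :=
  ∀ s : Sec (I.X j) U, app (I.d j k) U s = 0 → ∃ t : Sec (I.X i) U, app (I.d i j) U t = s

variable (I : CochainComplex (ModSheaf R Y) ℤ)
  {M : Type v} {B : Type w} [TopologicalSpace M] [TopologicalSpace B]
  {ψ : M × B → Y} (hψ : IsOpenEmbedding ψ)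

/-- The support of a section over the image of `M × B`, as a subset of `M`. -/
def fiberSupp {j : ℤ} (s : Sec (I.X j) (hψ.tube ⊤)) : Set M :=
  {x | ∀ V : Opens M, x ∈ V → res (I.X j) (hψ.tube_le_top V) s ≠ 0}

variable {I}

lemma disjoint_fiberSupp_iff {j : ℤ} (s : Sec (I.X j) (hψ.tube ⊤)) (V : Opens M) :
    Disjoint (fiberSupp I hψ s) V ↔ res (I.X j) (hψ.tube_le_top V) s = 0 := by
  rw [Set.disjoint_right]
  constructor
  · intro h
    refine eq_of_locally_eq _ fun y hy ↦ ?_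
    obtain ⟨x, b, hx, rfl⟩ := hψ.mem_tube.1 hy
    have := h hx
    simp only [fiberSupp, Set.mem_ofPred_eq, not_forall, not_not] at this
    obtain ⟨V', hx', e⟩ := this
    refine ⟨hψ.tube (V ⊓ V'), hψ.tube_mono inf_le_left, hψ.apply_mem_tube.2 ⟨hx, hx'⟩, ?_⟩
    rw [res_res, map_zero, ← res_res _ (hψ.tube_le_top V') (hψ.tube_mono inf_le_right), e, map_zero]
  · exact fun h x hx hx' ↦ hx' V hx h

lemma disjoint_fiberSupp_iff_exists {j : ℤ} (s : Sec (I.X j) (hψ.tube ⊤)) (K : Set M) :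
    Disjoint (fiberSupp I hψ s) K ↔
      ∃ V : Opens M, K ⊆ V ∧ res (I.X j) (hψ.tube_le_top V) s = 0 := by
  constructor
  · intro h
    have hc : IsClosed (fiberSupp I hψ s) := by
      rw [← isOpen_compl_iff, isOpen_iff_mem_nhds]
      intro x hx
      simp only [fiberSupp, Set.mem_compl_iff, Set.mem_ofPred_eq, not_forall, not_not] at hx
      obtain ⟨V, hV, e⟩ := hx
      filter_upwards [V.isOpen.mem_nhds hV] with z hz hz'
      exact hz' V hz e
    refine ⟨⟨_, hc.isOpen_compl⟩, fun x hx hx' ↦ Set.disjoint_left.1 h hx' hx, ?_⟩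
    exact (disjoint_fiberSupp_iff hψ s _).1 disjoint_compl_right
  · rintro ⟨V, hK, e⟩
    exact ((disjoint_fiberSupp_iff hψ s V).2 e).mono_right hK

variable (I) [∀ j, Injective (I.X j)]

/-- A complex of injective sheaves on the image of `M × B`, seen as a complex of flasque sheaves
on `M`. -/
def fiberComplex : SupportedComplex.{v, u} M where
  sec j := Sec (I.X j) (hψ.tube ⊤)
  d i j := (app (I.d i j) _).toAddMonoidHom
  d_d i j k s := by
    change app (I.d i j ≫ I.d j k) _ s = 0
    rw [I.d_comp_d]
    exact app_zero s
  supp s := fiberSupp I hψ s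
  isClosed_supp s := by
    rw [← isOpen_compl_iff, isOpen_iff_mem_nhds]
    intro x hx
    obtain ⟨V, hV, e⟩ := (disjoint_fiberSupp_iff_exists hψ s {x}).1
      (Set.disjoint_singleton_right.2 hx)
    filter_upwards [V.isOpen.mem_nhds (hV rfl)] with z hz hz'
    exact hz' V hz e
  supp_zero j := by
    have h := (disjoint_fiberSupp_iff hψ (0 : Sec (I.X j) _) ⊤).2 (map_zero _)
    simpa using h
  supp_sub {j} s t := by
    intro x hx
    by_contra h
    obtain ⟨V, hV, e⟩ := (disjoint_fiberSupp_iff_exists hψ s {x}).1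
      (Set.disjoint_singleton_right.2 fun h' ↦ h (Or.inl h'))
    obtain ⟨V', hV', e'⟩ := (disjoint_fiberSupp_iff_exists hψ t {x}).1
      (Set.disjoint_singleton_right.2 fun h' ↦ h (Or.inr h'))
    refine hx (V ⊓ V') ⟨hV rfl, hV' rfl⟩ ?_
    rw [map_sub, ← res_res _ (hψ.tube_le_top V) (hψ.tube_mono inf_le_left), e,
      ← res_res _ (hψ.tube_le_top V') (hψ.tube_mono inf_le_right), e', map_zero, map_zero, sub_zero]
  supp_d i j s x hx V hV e := hx V hV <| by
    change res _ _ (app _ _ s) = 0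
    rw [← app_res, e, map_zero]
  glue {j} ι U hU s hs := by
    let V (a : ι) : Opens M := ⟨U a, hU a⟩
    obtain ⟨t, ht⟩ := exists_glue (I.X j) (U := fun a ↦ hψ.tube (V a)) (V := ⨆ a, hψ.tube (V a))
      (fun a ↦ le_iSup (fun a ↦ hψ.tube (V a)) a) le_rfl
      (fun a ↦ res _ (hψ.tube_le_top (V a)) (s a)) (fun a b ↦ by
        have h := (disjoint_fiberSupp_iff hψ (s a - s b) (V a ⊓ V b)).1 (hs a b)
        rw [map_sub, sub_eq_zero] at h
        have h' := congrArg (res (I.X j) (hψ.inf_tube_le (V a) (V b))) h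
        simpa using h')
    -- Flasqueness extends the section glued on the union of the tubes to the full tube.
    obtain ⟨t, rfl⟩ := res_surjective (I.X j) (iSup_le fun a ↦ hψ.tube_le_top (V a)) t
    refine ⟨t, fun a ↦ (disjoint_fiberSupp_iff hψ (t - s a) (V a)).2 ?_⟩
    rw [map_sub, sub_eq_zero, ← ht a, res_res]

lemma fiberComplex_agree_iff {j : ℤ} (K : Set M) (s t : Sec (I.X j) (hψ.tube ⊤)) :
    (fiberComplex I hψ).Agree (j := j) K s t ↔ ∃ V : Opens M, K ⊆ V ∧
      res (I.X j) (hψ.tube_le_top V) s = res (I.X j) (hψ.tube_le_top V) t := by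
  refine (disjoint_fiberSupp_iff_exists hψ (s - t) K).trans ?_
  simp only [map_sub, sub_eq_zero]

variable {I}

lemma exactOn_of_exactNear {i j k : ℤ} (h : (fiberComplex I hψ).ExactNear i j k Set.univ) :
    ExactOn I i j k (hψ.tube ⊤) := by
  intro s hs
  obtain ⟨t, ht⟩ := h s ((fiberComplex_agree_iff I hψ _ _ _).2 ⟨⊤, subset_rfl, by
    exact congrArg (res (I.X k) _) hs⟩)
  obtain ⟨V, hV, e⟩ := (fiberComplex_agree_iff I hψ _ _ _).1 ht
  obtain rfl : V = ⊤ := by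
    rw [eq_top_iff]; exact hV
  exact ⟨t, (res_self _ _ _).symm.trans (e.trans (res_self _ _ _))⟩

/-- A primitive on a small tube extends to the full tube because injective sheaves are flasque; so
it suffices to find primitives over small V' × B. -/
lemma exactNear_singleton {i j k : ℤ} (x : M)
    (h : ∀ V : Opens M, x ∈ V → ∀ s : Sec (I.X j) (hψ.tube V), app (I.d j k) _ s = 0 →
      ∃ (V' : Opens M) (hV' : V' ≤ V), x ∈ V' ∧
        ∃ t : Sec (I.X i) (hψ.tube V'), app (I.d i j) _ t = res (I.X j) (hψ.tube_mono hV') s) :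
    (fiberComplex I hψ).ExactNear i j k {x} := by
  intro s hs
  obtain ⟨V, hV, e⟩ := (fiberComplex_agree_iff I hψ _ _ _).1 hs
  obtain ⟨V', hV', hx, t, ht⟩ := h V (hV rfl) (res _ (hψ.tube_le_top V) s)
    ((app_res _ _ _).trans (e.trans (map_zero _)))
  obtain ⟨t, rfl⟩ := res_surjective _ (hψ.tube_le_top V') t
  refine ⟨t, (fiberComplex_agree_iff I hψ _ _ _).2 ⟨V', Set.singleton_subset_iff.2 hx, ?_⟩⟩
  exact (app_res _ _ _).symm.trans (ht.trans (res_res _ _ _ _))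

end ModSheaf

lemma Topology.IsOpenEmbedding.exists_range_subset {E M : Type*} [NormedAddCommGroup E]
    [NormedSpace ℝ E] [TopologicalSpace M] {c : E → M} (hc : IsOpenEmbedding c) {x : M}
    (hx : x ∈ Set.range c) {V : Set M} (hV : IsOpen V) (hxV : x ∈ V) :
    ∃ c' : E → M, IsOpenEmbedding c' ∧ x ∈ Set.range c' ∧ Set.range c' ⊆ V := by
  obtain ⟨v, rfl⟩ := hx
  obtain ⟨r, hr, hrV⟩ := Metric.isOpen_iff.1 (hV.preimage hc.continuous) v hxV
  obtain ⟨β, hβ, hβr⟩ := exists_isOpenEmbedding_ball v hr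
  refine ⟨c ∘ β, hc.comp hβ, ?_, ?_⟩
  · rw [Set.range_comp, hβr]
    exact ⟨v, Metric.mem_ball_self hr, rfl⟩
  · rw [Set.range_comp, hβr, Set.image_subset_iff]
    exact hrV

/-! ### Vanishing of the cohomology of local systems on manifolds -/

namespace ModSheaf

open Topology

variable {R : Type u} [CommRing R] {Y : TopCat.{u}}

/-- The sheaf of cocycles of degree `0` is a constant sheaf in a neighbourhood of `y`. -/
def HasConstantCocycles (I : CochainComplex (ModSheaf R Y) ℤ) (y : Y) : Prop :=
  ∃ V : Opens Y, y ∈ V ∧ ∃ A : Set (Sec (I.X 0) V),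
    (∀ a ∈ A, app (I.d 0 1) V a = 0) ∧
    (∀ (W : Opens Y) (hW : W ≤ V), ∀ z ∈ W, ∀ g : Sec (I.X 0) W, app (I.d 0 1) W g = 0 →
      ∃ a ∈ A, ∃ (W' : Opens Y) (hW' : W' ≤ W), z ∈ W' ∧
        res (I.X 0) hW' g = res (I.X 0) (hW'.trans hW) a) ∧
    (∀ a ∈ A, ∀ b ∈ A, ∀ (W : Opens Y) (hW : W ≤ V), ∀ z ∈ W,
      res (I.X 0) hW a = res (I.X 0) hW b → a = b)

variable {I : CochainComplex (ModSheaf R Y) ℤ} [∀ j, Injective (I.X j)]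

/-- When B is a point, tubes form a neighbourhood basis, so exactness of sheaves is all that is
required. -/
lemma exactNear_singleton_of_exact {M : Type v} {B : Type w} [TopologicalSpace M]
    [TopologicalSpace B] [Unique B] {ψ : M × B → Y} (hψ : IsOpenEmbedding ψ) {i j k : ℤ}
    (h : (I.sc' i j k).Exact) (x : M) : (fiberComplex I hψ).ExactNear i j k {x} := by
  refine exactNear_singleton hψ x fun V hV s hs ↦ ?_
  obtain ⟨W, hWV, hW, t, ht⟩ := (exact_iff_locally _).1 h (hψ.tube V) s hs (ψ (x, default))
    (hψ.apply_mem_tube.2 hV)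
  let V' : Opens M := ⟨(fun z ↦ ψ (z, default)) ⁻¹' W,
    W.isOpen.preimage (hψ.continuous.comp (Continuous.prodMk_left default))⟩
  have hV'W : hψ.tube V' ≤ W := by
    intro y hy
    obtain ⟨z, b, hz, rfl⟩ := hψ.mem_tube.1 hy
    rw [Unique.eq_default b]
    exact hz
  refine ⟨V', fun z hz ↦ hψ.apply_mem_tube.1 (hWV hz), hW, res _ hV'W t, ?_⟩
  refine (app_res _ _ _).trans ((congrArg (res (I.X j) hV'W) ht).trans ?_)
  exact res_res _ _ _ _

lemma isLocallyConstant_fiberComplex {M : Type v} {B : Type w} [TopologicalSpace M]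
    [TopologicalSpace B] [Unique B] {ψ : M × B → Y} (hψ : IsOpenEmbedding ψ)
    (hZ : ∀ y, HasConstantCocycles I y) : (fiberComplex I hψ).IsLocallyConstant := by
  intro x
  obtain ⟨V₀, hxV, A, hA, hAs, hAi⟩ := hZ (ψ (x, default))
  have hpre (W : Opens Y) : ∃ V : Opens M, (∀ z, z ∈ V ↔ ψ (z, default) ∈ W) ∧ hψ.tube V ≤ W := by
    refine ⟨⟨(fun z ↦ ψ (z, default)) ⁻¹' W,
      W.isOpen.preimage (hψ.continuous.comp (Continuous.prodMk_left default))⟩,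
      fun _ ↦ Iff.rfl, fun y hy ↦ ?_⟩
    obtain ⟨z, b, hz, rfl⟩ := hψ.mem_tube.1 hy
    rw [Unique.eq_default b]
    exact hz
  obtain ⟨V, hV, hVV⟩ := hpre V₀
  refine ⟨V, V.isOpen, (hV x).2 hxV, {a : Sec (I.X 0) (hψ.tube ⊤) | ∃ a₀ ∈ A,
    res _ (hψ.tube_le_top V) a = res _ hVV a₀}, ?_, ?_, ?_⟩
  · rintro a ⟨a₀, ha₀, e⟩
    refine (fiberComplex_agree_iff I hψ _ _ _).2 ⟨V, subset_rfl, ?_⟩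
    refine (app_res _ _ _).symm.trans ((congrArg (app _ _) e).trans ((app_res _ _ _).trans ?_))
    rw [hA a₀ ha₀]
    exact (map_zero _).trans (map_zero _).symm
  · intro z hz (g : Sec (I.X 0) (hψ.tube ⊤)) hg
    obtain ⟨V₁, hV₁, e⟩ := (fiberComplex_agree_iff I hψ _ _ _).1 hg
    have hg' : app (I.d 0 1) _ (res _ (hψ.tube_le_top (V ⊓ V₁)) g) = 0 := by
      refine (app_res _ _ _).trans ((res_res _ (hψ.tube_le_top V₁)
        (hψ.tube_mono inf_le_right) _).symm.trans ((congrArg (res _ _) e).trans ?_))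
      exact (congrArg (res _ _) (map_zero _)).trans (map_zero _)
    obtain ⟨a₀, ha₀, W, hW, hzW, e'⟩ := hAs _ ((hψ.tube_mono inf_le_left).trans hVV)
      (ψ (z, default)) (hψ.apply_mem_tube.2 ⟨hz, hV₁ rfl⟩) _ hg'
    obtain ⟨a, ha⟩ := res_surjective _ (hψ.tube_le_top V) (res _ hVV a₀)
    refine ⟨a, ⟨a₀, ha₀, ha⟩, (fiberComplex_agree_iff I hψ _ _ _).2 ?_⟩
    obtain ⟨V₂, hV₂, hV₂W⟩ := hpre W
    refine ⟨V₂, Set.singleton_subset_iff.2 ((hV₂ z).2 hzW), ?_⟩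
    have hV₂V : hψ.tube V₂ ≤ hψ.tube V := hV₂W.trans (hW.trans (hψ.tube_mono inf_le_left))
    have e₁ := congrArg (res (I.X 0) hV₂W) e'
    have e₂ := congrArg (res (I.X 0) hV₂V) ha
    simp only [res_res] at e₁ e₂
    exact e₁.trans e₂.symm
  · rintro (a : Sec (I.X 0) (hψ.tube ⊤)) ⟨a₀, ha₀, ea⟩
      (b : Sec (I.X 0) (hψ.tube ⊤)) ⟨b₀, hb₀, eb⟩ z hz hab
    obtain ⟨V₁, hV₁, e⟩ := (fiberComplex_agree_iff I hψ _ _ _).1 hab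
    have e' : a₀ = b₀ := by
      refine hAi a₀ ha₀ b₀ hb₀ (hψ.tube (V ⊓ V₁)) ((hψ.tube_mono inf_le_left).trans hVV)
        (ψ (z, default)) (hψ.apply_mem_tube.2 ⟨hz, hV₁ rfl⟩) ?_
      have e₁ := congrArg (res (I.X 0) (hψ.tube_mono (inf_le_left : V ⊓ V₁ ≤ V))) ea
      have e₂ := congrArg (res (I.X 0) (hψ.tube_mono (inf_le_left : V ⊓ V₁ ≤ V))) eb
      have e₃ := congrArg (res (I.X 0) (hψ.tube_mono (inf_le_right : V ⊓ V₁ ≤ V₁))) e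
      simp only [res_res] at e₁ e₂ e₃
      exact e₁.symm.trans (e₃.trans e₂)
    subst e'
    exact (fiberComplex_agree_iff I hψ _ _ _).2 ⟨V, subset_rfl, ea.trans eb.symm⟩

/-- A resolution of a local system by injective sheaves is exact on euclidean open subsets. -/
lemma exactOn_of_euclidean (hZ : ∀ y, HasConstantCocycles I y)
    (hE : ∀ j : ℤ, 1 ≤ j → (I.sc' (j - 1) j (j + 1)).Exact) {n : ℕ} {c : (Fin n → ℝ) → Y}
    (hc : IsOpenEmbedding c) {U : Opens Y} (hU : (U : Set Y) = Set.range c) {j : ℤ} (hj : 1 ≤ j) :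
    ExactOn I (j - 1) j (j + 1) U := by
  have hψ : IsOpenEmbedding (c ∘ Homeomorph.prodUnique (Fin n → ℝ) Unit) :=
    hc.comp (Homeomorph.prodUnique (Fin n → ℝ) Unit).isOpenEmbedding
  obtain rfl : U = hψ.tube ⊤ := by
    ext y
    rw [hU, SetLike.mem_coe, hψ.mem_tube_top]
    simp
  exact exactOn_of_exactNear hψ ((isLocallyConstant_fiberComplex hψ hZ).exactNear_univ
    (fun j hj y ↦ exactNear_singleton_of_exact hψ (hE j hj) y) j hj)

/-- A resolution of a local system by injective sheaves is exact, in degrees above the dimension of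
the manifold `M`, on open subsets of the form `M × ℝᵇ`. -/
lemma exactOn_of_manifold (hZ : ∀ y, HasConstantCocycles I y)
    (hE : ∀ j : ℤ, 1 ≤ j → (I.sc' (j - 1) j (j + 1)).Exact)
    {M : Type v} [TopologicalSpace M] [T2Space M] [WeaklyLocallyCompactSpace M]
    [SigmaCompactSpace M] {d : ℕ}
    (hM : ∀ y : M, ∃ c : (Fin d → ℝ) → M, IsOpenEmbedding c ∧ y ∈ Set.range c)
    {B : Type w} [NormedAddCommGroup B] [NormedSpace ℝ B] [FiniteDimensional ℝ B]
    {ψ : M × B → Y} (hψ : IsOpenEmbedding ψ) {U : Opens Y} (hU : (U : Set Y) = Set.range ψ)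
    {j : ℤ} (hj : d + 1 ≤ j) :
    ExactOn I (j - 1) j (j + 1) U := by
  obtain rfl : U = hψ.tube ⊤ := by
    ext y
    rw [hU, SetLike.mem_coe, hψ.mem_tube_top]
  refine exactOn_of_exactNear hψ (SupportedComplex.exactNear_univ_of_charts hM
    (fun j hj y ↦ exactNear_singleton hψ y fun V hV s hs ↦ ?_) j hj)
  obtain ⟨c, hc, hy⟩ := hM y
  obtain ⟨c, hc, hy, hcV⟩ := hc.exists_range_subset hy V.isOpen hV
  -- For a chart domain V' in M the tube V' × B is itself euclidean, so the Poincaré lemma supplies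
  -- exactness near the point of M in every degree ≥ 1.
  have hN : Module.finrank ℝ (Fin (Module.finrank ℝ ((Fin d → ℝ) × B)) → ℝ) =
    Module.finrank ℝ ((Fin d → ℝ) × B) := by simp
  let e := (ContinuousLinearEquiv.ofFinrankEq hN).toHomeomorph
  have hc' : IsOpenEmbedding (ψ ∘ Prod.map c id ∘ e) :=
    hψ.comp ((hc.prodMap .id).comp e.isOpenEmbedding)
  let V' : Opens M := ⟨Set.range c, hc.isOpen_range⟩
  have hV' : V' ≤ V := hcV
  refine ⟨V', hV', hy, ?_⟩
  refine exactOn_of_euclidean hZ hE hc' (U := hψ.tube V') ?_ hj _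
    ((app_res _ _ _).trans ((congrArg (res _ _) hs).trans (map_zero _)))
  ext y
  rw [SetLike.mem_coe, hψ.mem_tube]
  constructor
  · rintro ⟨x, b, ⟨v, rfl⟩, rfl⟩
    exact ⟨e.symm (v, b), by simp⟩
  · rintro ⟨v, rfl⟩
    exact ⟨c (e v).1, (e v).2, ⟨_, rfl⟩, rfl⟩

end ModSheaf

/-! ### Injective resolutions of local systems -/

namespace ModSheaf

open Topology

variable {R : Type u} [CommRing R] {Y : TopCat.{u}}

/-- A local system is locally given by a set of sections which have distinct germs and represent
every germ. -/
lemma exists_sections_of_isLocalSystem {G : ModSheaf R Y} (hG : IsLocalSystem G) (y : Y) :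
    ∃ V : Opens Y, y ∈ V ∧ ∃ A : Set (Sec G V),
      (∀ (W : Opens Y) (hW : W ≤ V), ∀ z ∈ W, ∀ g : Sec G W,
        ∃ a ∈ A, ∃ (W' : Opens Y) (hW' : W' ≤ W), z ∈ W' ∧
          res G hW' g = res G (hW'.trans hW) a) ∧
      (∀ a ∈ A, ∀ b ∈ A, ∀ (W : Opens Y) (hW : W ≤ V), ∀ z ∈ W,
        res G hW a = res G hW b → a = b) := by
  obtain ⟨V, hy, ⟨M₀, ⟨e⟩⟩⟩ := hG y
  refine ⟨V, hy, ?_⟩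
  let J := Opens.grothendieckTopology V
  let P : (Opens V)ᵒᵖ ⥤ ModuleCat.{u} R := (Functor.const _).obj M₀
  let ε : sheafify J P ⟶ (V.sheafRestrict.obj G).obj := e.hom.hom
  have : IsIso ε := inferInstanceAs (IsIso ((sheafToPresheaf J _).map e.hom))
  -- A constant sheaf is the sheafification of a constant presheaf, so σ is locally bijective: local
  -- surjectivity represents all germs, local injectivity keeps them distinct.
  let σ : P ⟶ (V.sheafRestrict.obj G).obj := toSheafify J P ≫ ε
  have hσs : Presheaf.IsLocallySurjective J σ := inferInstance
  have hσi : Presheaf.IsLocallyInjective J σ := inferInstance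
  let im (W : Opens V) : Opens Y := ⟨Subtype.val '' (W : Set V),
    V.isOpen.isOpenEmbedding_subtypeVal.isOpenMap _ W.isOpen⟩
  let pre (W : Opens Y) : Opens V := ⟨Subtype.val ⁻¹' (W : Set Y),
    W.isOpen.preimage continuous_subtype_val⟩
  have him (W : Opens Y) : im (pre W) ≤ W := by
    rintro _ ⟨z, hz, rfl⟩
    exact hz
  have him' {W W' : Opens V} (h : W ≤ W') : im W ≤ im W' := Set.image_mono h
  have htop : V ≤ im ⊤ := fun z hz ↦ ⟨⟨z, hz⟩, trivial, rfl⟩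
  have him'' (W : Opens V) : im W ≤ V := by
    rintro _ ⟨z, hz, rfl⟩
    exact z.2
  let τ (W : Opens V) (a : M₀) : Sec G (im W) := (σ.app (op W)).hom a
  have hτ (W : Opens V) (a : M₀) : τ W a = res G (him' le_top) (τ ⊤ a) :=
    ConcreteCategory.congr_hom (σ.naturality (homOfLE (le_top : W ≤ ⊤)).op) a
  let T (a : M₀) : Sec G V := res G htop (τ ⊤ a)
  refine ⟨Set.range T, fun W hW z hz g ↦ ?_, ?_⟩
  · obtain ⟨W', i, ⟨t, ht⟩, hzW'⟩ := hσs.imageSieve_mem (U := pre W) (res G (him W) g) ⟨z, hW hz⟩ hz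
    refine ⟨T t, ⟨t, rfl⟩, im W', (him' i.le).trans (him W), ⟨_, hzW', rfl⟩, ?_⟩
    have ht' : τ W' t = res G (him' i.le) (res G (him W) g) := ht
    rw [res_res] at ht'
    rw [← ht', hτ]
    exact (res_res _ _ _ _).symm
  · rintro _ ⟨a, rfl⟩ _ ⟨b, rfl⟩ W hW z hz e
    have e' : τ (pre W) a = τ (pre W) b := by
      have e₁ := congrArg (res G (him W)) e
      simp only [T, res_res] at e₁
      rw [hτ, hτ (pre W) b]
      exact e₁
    -- Restriction in the constant presheaf is the identity, so agreement on one member of the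
    -- covering is already equality in M₀; the point z provides such a member.
    obtain ⟨W', i, h, -⟩ := hσi.equalizerSieve_mem (X := op (pre W)) a b e' ⟨z, hW hz⟩ hz
    have h' : a = b := h
    rw [h']

/-- Local systems have resolutions by injective sheaves which are exact on suitable subsets. -/
lemma exists_resolution {G : ModSheaf R Y}
    (hG : IsLocalSystem G) :
    ∃ I : HomotopyCategory.Plus (ModSheaf R Y), (∀ j, Injective (I.obj.as.X j)) ∧
      Nonempty (DerivedCategory.Plus.Qh.obj I ≅ sheafInDegreeZero G) ∧
      (∀ j : ℤ, 1 ≤ j → (I.obj.as.sc' (j - 1) j (j + 1)).Exact) ∧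
      ∀ y, HasConstantCocycles I.obj.as y := by
  let ρ := injectiveResolution G
  let K : CochainComplex.Plus (ModSheaf R Y) := ⟨ρ.cochainComplex, 0, inferInstance⟩
  refine ⟨(HomotopyCategory.Plus.quotient _).obj K, fun j ↦ inferInstanceAs
    (Injective (ρ.cochainComplex.X j)), ?_, ?_, ?_⟩
  · exact ⟨DerivedCategory.Plus.ι.preimageIso
      (asIso (DerivedCategory.Q.map ρ.ι')).symm⟩
  · intro j hj
    have h : ρ.cochainComplex.ExactAt j :=
      CochainComplex.exactAt_of_isLE ρ.cochainComplex 0 j (by lia)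
    exact (HomologicalComplex.exactAt_iff' _ _ _ _ (by simp) (by simp)).1 h
  · intro y
    change HasConstantCocycles ρ.cochainComplex y
    let f₀ : G ⟶ ρ.cocomplex.X 0 := ρ.ι.f 0
    have hf₀ : f₀ ≫ ρ.cocomplex.d 0 1 = 0 := ρ.ι_f_zero_comp_complex_d
    have : Mono f₀ := inferInstanceAs (Mono (ρ.ι.f 0))
    have hd : (ρ.cochainComplexXIso 0 0 rfl).inv ≫ ρ.cochainComplex.d 0 1 =
        ρ.cocomplex.d 0 1 ≫ (ρ.cochainComplexXIso 1 1 rfl).inv := by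
      rw [ρ.cochainComplex_d 0 1 0 1 rfl rfl, Iso.inv_hom_id_assoc]
    let f : G ⟶ ρ.cochainComplex.X 0 := f₀ ≫ (ρ.cochainComplexXIso 0 0 rfl).inv
    have hf : f ≫ ρ.cochainComplex.d 0 1 = 0 := by
      rw [Category.assoc, hd, reassoc_of% hf₀, Limits.zero_comp]
    -- G is the sheaf of cocycles of degree 0, so the sections representing its germs provide the
    -- constant cocycles.
    have hex : (ShortComplex.mk f (ρ.cochainComplex.d 0 1) hf).Exact :=
      (ShortComplex.exact_iff_of_iso (ShortComplex.isoMk (S₁ := .mk _ _ hf₀) (S₂ := .mk _ _ hf)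
        (Iso.refl _) (ρ.cochainComplexXIso 0 0 rfl).symm (ρ.cochainComplexXIso 1 1 rfl).symm
        (Category.id_comp _) hd)).1
        ((ShortComplex.mk _ _ hf₀).exact_of_f_is_kernel ρ.isLimitKernelFork)
    have : Mono f := mono_comp _ _
    obtain ⟨V, hyV, A, hA, hA'⟩ := exists_sections_of_isLocalSystem hG y
    refine ⟨V, hyV, app f V '' A, ?_, ?_, ?_⟩
    · rintro _ ⟨a, ha, rfl⟩
      rw [← app_comp, hf]
      rfl
    · intro W hW z hz g hg
      obtain ⟨W₁, hW₁, hz₁, t, ht⟩ := (exact_iff_locally _).1 hex W g hg z hz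
      obtain ⟨a, ha, W', hW', hzW', e⟩ := hA W₁ (hW₁.trans hW) z hz₁ t
      refine ⟨_, ⟨a, ha, rfl⟩, W', hW'.trans hW₁, hzW', ?_⟩
      have e' := congrArg (app f W') e
      rw [app_res, app_res] at e'
      refine Eq.trans ?_ e'
      refine (res_res _ _ _ _).symm.trans (congrArg (res _ _) ht.symm)
    · rintro _ ⟨a, ha, rfl⟩ _ ⟨b, hb, rfl⟩ W hW z hz e
      rw [← app_res, ← app_res] at e
      rw [hA' a ha b hb W hW z hz (app_injective f W e)]

end ModSheaf

/-! ### Vanishing for the derived direct image from the regular part -/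

lemma DerivedCategory.Plus.isLE_Qh_obj {A : Type*} [Category* A] [Abelian A]
    [HasDerivedCategory A] (I : HomotopyCategory.Plus A) (m : ℤ)
    (h : ∀ j, m < j → (I.obj.as.sc' (j - 1) j (j + 1)).Exact) :
    (DerivedCategory.Plus.Qh.obj I).IsLE m := by
  have : CochainComplex.IsLE I.obj.as m := by
    rw [CochainComplex.isLE_iff]
    intro j hj
    exact (HomologicalComplex.exactAt_iff' _ _ _ _ (by simp) (by simp)).2 (h j hj)
  rw [← DerivedCategory.Plus.isLE_ι_obj_iff]
  exact DerivedCategory.TStructure.t.isLE_of_iso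
    ((DerivedCategory.quotientCompQhIso A).symm.app I.obj.as) m

open ModSheaf in
/-- Local criterion for the exactness of a direct image. -/
lemma ModSheaf.exact_pushforward_iff {R : Type u} [CommRing R] {Y Z : TopCat.{u}} (f : Y ⟶ Z)
    (I : CochainComplex (ModSheaf R Y) ℤ) (i j k : ℤ) :
    ((((TopCat.Sheaf.pushforward (ModuleCat.{u} R) f).mapHomologicalComplex _).obj I).sc'
      i j k).Exact ↔
    ∀ (U : Opens Z) (s : Sec (I.X j) ((Opens.map f).obj U)), app (I.d j k) _ s = 0 → ∀ y ∈ U,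
      ∃ (V : Opens Z) (hV : V ≤ U), y ∈ V ∧ ∃ t : Sec (I.X i) ((Opens.map f).obj V),
        app (I.d i j) _ t = res (I.X j) ((Opens.map f).map (homOfLE hV)).le s :=
  exact_iff_locally _

namespace StratifiedPseudomanifold

open Topology ModSheaf

variable {R : Type u} [CommRing R] {n : ℕ} {X : TopCat.{u}} (S : StratifiedPseudomanifold n X)

/-- The complex `i_* I` on `U_{k+1}` is exact in degrees `≥ k`, if `I` is an injective resolution of
a local system on `U_1`. -/
lemma exact_pushforward {I : CochainComplex (ModSheaf R (S.U 1)) ℤ} [∀ j, Injective (I.X j)]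
    (hZ : ∀ y, HasConstantCocycles I y)
    (hE : ∀ j : ℤ, 1 ≤ j → (I.sc' (j - 1) j (j + 1)).Exact) {k : ℕ} (hk : 1 ≤ k) {j : ℤ}
    (hj : k ≤ j) :
    ((((TopCat.Sheaf.pushforward (ModuleCat.{u} R)
      (S.incl (Nat.le_add_left 1 k))).mapHomologicalComplex _).obj I).sc' (j - 1) j (j + 1)).Exact := by
  have h := S.isTopologicalStratification
  rw [exact_pushforward_iff]
  intro U s hs y hy
  obtain ⟨l, hl, hyl, hyl'⟩ := h.exists_stratum y.1
  -- Points of U_{k+1} lie in strata of codimension at most k.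
  have hlk : l ≤ k := by
    by_contra hlk
    exact y.2 (h.mono (by push_cast; lia) hyl)
  have hUX : IsOpen (Subtype.val '' (U : Set (S.U (k + 1)))) :=
    (S.opens (k + 1)).isOpen.isOpenEmbedding_subtypeVal.isOpenMap _ U.isOpen
  cases l with
  | zero =>
    have hy1 : y.1 ∉ S.skeleton (n - 1) := by simpa using hyl'
    -- At a regular point the resolution itself is exact in degree j, since j ≥ k ≥ 1.
    obtain ⟨V, hV, hyV, t, ht⟩ := (exact_iff_locally _).1 (hE j (by lia)) _ _ hs ⟨y.1, hy1⟩ hy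
    let N : Set X := Subtype.val '' (V : Set (S.U 1))
    have hN : IsOpen N := (S.opens 1).isOpen.isOpenEmbedding_subtypeVal.isOpenMap _ V.isOpen
    let V' : Opens (S.U (k + 1)) := ⟨Subtype.val ⁻¹' N, hN.preimage continuous_subtype_val⟩
    have hV' : V' ≤ U := by
      rintro z ⟨z', hz', e⟩
      obtain rfl : z = S.incl (Nat.le_add_left 1 k) z' := Subtype.ext e.symm
      exact hV hz'
    have hVV : (Opens.map (S.incl (Nat.le_add_left 1 k))).obj V' ≤ V := by
      rintro z ⟨z', hz', e⟩
      obtain rfl : z' = z := Subtype.ext e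
      exact hz'
    refine ⟨V', hV', ⟨_, hyV, rfl⟩, res _ hVV t, ?_⟩
    exact (app_res (I.d (j - 1) j) hVV t).trans ((congrArg (res (I.X j) hVV) ht).trans
      (res_res (I.X j) hV hVV s))
  | succ l =>
    obtain ⟨L, _, G, _, hG, a, hN⟩ := h.exists_link hl hyl hyl'
    obtain ⟨N, hNo, hyN, hNU, ψ, hψ, hψN⟩ := hN _ hUX ⟨y, hy, rfl⟩
    have := hG.t2Space
    have := hG.sigmaCompactSpace
    have : LocallyCompactSpace ((G (l - 1))ᶜ : Set L) :=
      (hG.isClosed _).isOpen_compl.locallyCompactSpace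
    let V' : Opens (S.U (k + 1)) := ⟨Subtype.val ⁻¹' N, hNo.preimage continuous_subtype_val⟩
    have hV' : V' ≤ U := by
      intro z hz
      obtain ⟨z', hz', e⟩ := hNU hz
      obtain rfl : z' = z := Subtype.ext e
      exact hz'
    have hψ1 (z) : ψ z ∈ S.opens 1 := (hψN.le ⟨z, rfl⟩).2
    have hψ' : IsOpenEmbedding (fun z ↦ (⟨ψ z, hψ1 z⟩ : S.U 1)) :=
      .of_comp _ (S.opens 1).isOpen.isOpenEmbedding_subtypeVal hψ
    refine ⟨V', hV', hyN, ?_⟩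
    -- The regular part of the link has dimension l, one less than the codimension l + 1, so
    -- exactness holds in degrees ≥ l + 1, and l + 1 ≤ k ≤ j.
    refine exactOn_of_manifold (I := I) hZ hE (fun x ↦ hG.exists_chart x.2) hψ'
      (U := (Opens.map (S.incl (Nat.le_add_left 1 k))).obj V') ?_ (j := j) (by lia) _ ?_
    · ext z
      constructor
      · intro hz
        obtain ⟨w, hw⟩ := hψN.ge (⟨hz, z.2⟩ : z.1 ∈ N \ S.skeleton (n - 1))
        exact ⟨w, Subtype.ext hw⟩
      · rintro ⟨w, rfl⟩
        exact (hψN.le ⟨w, rfl⟩).1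
    · exact (app_res _ _ _).trans ((congrArg (res _ _) hs).trans (map_zero _))

/-- The cohomology sheaves of `R i_* G` on `U_{k+1}` vanish in degrees `≥ k`. -/
lemma isLE_derivedPushforward {G : ModSheaf R (S.U 1)} (hG : IsLocalSystem G) {k : ℕ}
    (hk : 1 ≤ k) :
    ((derivedPushforward R (S.incl (Nat.le_add_left 1 k))).obj (sheafInDegreeZero G)).IsLE
      (k - 1 : ℤ) := by
  obtain ⟨I, _, ⟨e⟩, hE, hZ⟩ := exists_resolution hG
  have := DerivedCategory.Plus.isLE_Qh_obj ((TopCat.Sheaf.pushforward (ModuleCat.{u} R)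
      (S.incl (Nat.le_add_left 1 k))).mapHomotopyCategoryPlus.obj I) (k - 1 : ℤ)
    (fun j hj ↦ S.exact_pushforward hZ hE hk (j := j) (by lia))
  exact DerivedCategory.Plus.TStructure.t.isLE_of_iso
    ((Functor.rightDerivedFunctorPlusObjIso _ I).symm ≪≫
      (derivedPushforward R (S.incl (Nat.le_add_left 1 k))).mapIso e) _

end StratifiedPseudomanifold

/-! ### Direct images and the Deligne sheaf -/

section DirectImages

open DerivedCategory.Plus

variable {R : Type u} [CommRing R] {X Y Z : TopCat.{u}}

lemma nonempty_derivedPushforward_comp_iso (f : X ⟶ Y) (g : Y ⟶ Z) (h : X ⟶ Z) (e : f ≫ g = h)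
    (K : DPlus R X) : Nonempty ((derivedPushforward R g).obj ((derivedPushforward R f).obj K) ≅
      (derivedPushforward R h).obj K) := by
  subst e
  exact Functor.nonempty_rightDerivedFunctorPlus_comp_iso _ _ _ (Iso.refl _)
    (fun I _ ↦ ModSheaf.pushforward_obj_injective f I) K

lemma nonempty_derivedPushforward_id_iso (f : X ⟶ X) (e : f = 𝟙 X) (K : DPlus R X) :
    Nonempty ((derivedPushforward R f).obj K ≅ K) := by
  subst e
  exact Functor.nonempty_rightDerivedFunctorPlus_id_iso _ (Iso.refl _) K

/-- Global sections of f_*F are those of F, and f_* preserves injectives: hypercohomology of Rf_*K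
is that of K. -/
lemma nonempty_globalSections_derivedPushforward_iso (f : X ⟶ Y) (K : DPlus R X) :
    Nonempty ((globalSections R Y).rightDerivedFunctorPlus.obj ((derivedPushforward R f).obj K) ≅
      (globalSections R X).rightDerivedFunctorPlus.obj K) :=
  Functor.nonempty_rightDerivedFunctorPlus_comp_iso _ _ _ (Iso.refl _)
    (fun I _ ↦ ModSheaf.pushforward_obj_injective f I) K

end DirectImages

lemma Perversity.mono (p : Perversity) {m k : ℕ} (hm : 1 ≤ m) (hk : m ≤ k) : p m ≤ p k := by
  induction k, hk using Nat.le_induction with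
  | base => rfl
  | succ k hk ih => exact ih.trans (p.le_succ k (hm.trans hk))

namespace StratifiedPseudomanifold

open DerivedCategory.Plus

variable {R : Type u} [CommRing R] {n : ℕ} {X : TopCat.{u}} (S : StratifiedPseudomanifold n X)
  (p : Perversity) (G : ModSheaf R (S.U 1))

/-- Derived direct images are left t-exact and truncation from above preserves this bound, whatever
the values of p. -/
instance isGE_deligne (k : ℕ) : (S.deligne p G k).IsGE 0 := by
  induction k with
  | zero => exact inferInstanceAs ((sheafInDegreeZero G).IsGE 0)
  | succ k ih =>
    have := Functor.isGE_rightDerivedFunctorPlus_obj (TopCat.Sheaf.pushforward (ModuleCat.{u} R)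
      (S.incl (Nat.le_succ (k + 1)))) (S.deligne p G k) 0
    exact inferInstanceAs (TStructure.t.IsGE ((TStructure.t.truncLE (p (k + 1))).obj
      ((derivedPushforward R (S.incl (Nat.le_succ (k + 1)))).obj (S.deligne p G k))) 0)

variable {p G}

/-- The Deligne sheaf is a derived direct image as long as the perversity is large. -/
lemma nonempty_deligne_iso (hG : IsLocalSystem G) (k : ℕ)
    (hp : ∀ i : ℕ, 1 ≤ i → i ≤ k → (i : ℤ) - 1 ≤ p i) :
    Nonempty (S.deligne p G k ≅
      (derivedPushforward R (S.incl (Nat.le_add_left 1 k))).obj (sheafInDegreeZero G)) := by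
  induction k with
  | zero =>
    obtain ⟨e⟩ := nonempty_derivedPushforward_id_iso (S.incl (Nat.le_add_left 1 0)) rfl
      (sheafInDegreeZero G)
    exact ⟨e.symm⟩
  | succ k ih =>
    obtain ⟨e⟩ := ih fun i h1 h2 ↦ hp i h1 (h2.trans (Nat.le_succ k))
    obtain ⟨e'⟩ := nonempty_derivedPushforward_comp_iso (S.incl (Nat.le_add_left 1 k))
      (S.incl (Nat.le_succ (k + 1))) (S.incl (Nat.le_add_left 1 (k + 1))) rfl (sheafInDegreeZero G)
    -- Cohomology vanishes above degree k and p(k + 1) ≥ k, so truncation is an isomorphism.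
    have hLE := S.isLE_derivedPushforward hG (k := k + 1) (by lia)
    have hk := hp (k + 1) (by lia) le_rfl
    have := TStructure.t.isLE_of_le ((derivedPushforward R
      (S.incl (Nat.le_add_left 1 (k + 1)))).obj (sheafInDegreeZero G)) _ (p (k + 1)) hk
    exact ⟨(TStructure.t.truncLE (p (k + 1))).mapIso
      ((derivedPushforward R (S.incl (Nat.le_succ (k + 1)))).mapIso e ≪≫ e') ≪≫
      asIso ((TStructure.t.truncLEι (p (k + 1))).app _)⟩

/-- The comparison map from the Deligne sheaf to the derived direct image. -/
lemma exists_deligne_hom (hG : IsLocalSystem G) (m : ℕ)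
    (hp : ∀ i : ℕ, 1 ≤ i → i ≤ m → (i : ℤ) - 1 ≤ p i) (k : ℕ) :
    ∃ f : S.deligne p G k ⟶
      (derivedPushforward R (S.incl (Nat.le_add_left 1 k))).obj (sheafInDegreeZero G),
      HasConeGE f m := by
  induction k with
  | zero =>
    obtain ⟨e⟩ := S.nonempty_deligne_iso hG 0 (p := p) (by lia)
    exact ⟨e.hom, .of_isIso _ _⟩
  | succ k ih =>
    by_cases hkm : k + 1 ≤ m
    · obtain ⟨e⟩ := S.nonempty_deligne_iso hG (k + 1) fun i h1 h2 ↦ hp i h1 (h2.trans hkm)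
      exact ⟨e.hom, .of_isIso _ _⟩
    obtain ⟨f, hf⟩ := ih
    obtain ⟨e⟩ := nonempty_derivedPushforward_comp_iso (S.incl (Nat.le_add_left 1 k))
      (S.incl (Nat.le_succ (k + 1))) (S.incl (Nat.le_add_left 1 (k + 1))) rfl (sheafInDegreeZero G)
    let K := (derivedPushforward R (S.incl (Nat.le_succ (k + 1)))).obj (S.deligne p G k)
    -- The cone is τ_{>p(k+1)} K, and p(k + 1) + 1 ≥ p(m) + 1 ≥ m by monotonicity if m ≥ 1. If m =
    -- 0, p may be negative, and the bound comes from K living in degrees ≥ 0.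
    have hK : HasConeGE ((TStructure.t.truncLEι (p (k + 1))).app K) m := by
      refine .of_triangle ((TStructure.t.triangleLEGT (p (k + 1))).obj K)
        (TStructure.t.triangleLEGT_distinguished (p (k + 1)) K) ?_
      change ((TStructure.t.truncGT (p (k + 1))).obj K).IsGE m
      rcases m.eq_zero_or_pos with rfl | hm
      · have := Functor.isGE_rightDerivedFunctorPlus_obj (TopCat.Sheaf.pushforward (ModuleCat.{u} R)
          (S.incl (Nat.le_succ (k + 1)))) (S.deligne p G k) 0
        exact inferInstanceAs (TStructure.t.IsGE ((TStructure.t.truncGT (p (k + 1))).obj K) 0)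
      · refine TStructure.t.isGE_of_ge _ m (p (k + 1) + 1) ?_
        have := p.mono hm (by lia : m ≤ k + 1)
        have := hp m hm le_rfl
        lia
    exact ⟨_, hK.comp ((hf.rightDerivedFunctorPlus_map _).comp (.of_isIso e.hom m))⟩

end StratifiedPseudomanifold

theorem proposition3p1 {R : Type u} [CommRing R] {n : ℕ} {X : TopCat.{u}}
    (S : StratifiedPseudomanifold n X) (p : Perversity)
    (G : ModSheaf R (S.U 1)) (hG : IsLocalSystem G)
    (m : ℕ) (hp : ∀ k : ℕ, 1 ≤ k → k ≤ m → (k : ℤ) - 1 ≤ p k) :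
    (∀ j : ℤ, j ≤ (m : ℤ) - 1 →
      Nonempty (S.intersectionCohomology p G j ≅ sheafCohomology G j)) ∧
    (m ≤ n → Nonempty (S.deligne p G m ≅
      (derivedPushforward R (S.incl (Nat.le_add_left 1 m))).obj (sheafInDegreeZero G))) ∧
    (∃ f : S.deligneSheaf p G ⟶ (derivedPushforward R (S.inclX 1)).obj (sheafInDegreeZero G),
      ∀ j : ℤ, j ≤ (m : ℤ) - 1 →
        IsIso ((DerivedCategory.Plus.homologyFunctor (ModSheaf R X) j).map f)) := by
  -- The comparison on U_{n+1} is transported to X by the derived direct image along U_{n+1} = X.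
  obtain ⟨f, hf⟩ := S.exists_deligne_hom hG m hp n
  obtain ⟨e⟩ := nonempty_derivedPushforward_comp_iso (S.incl (Nat.le_add_left 1 n))
    (S.inclX (n + 1)) (S.inclX 1) rfl (sheafInDegreeZero G)
  have hF : DerivedCategory.Plus.HasConeGE
      ((derivedPushforward R (S.inclX (n + 1))).map f ≫ e.hom) m :=
    (hf.rightDerivedFunctorPlus_map _).comp (.of_isIso e.hom m)
  refine ⟨fun j hj ↦ ?_, fun _ ↦ S.nonempty_deligne_iso hG m hp,
    _, fun j hj ↦ hF.isIso_homology j (by lia)⟩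
  obtain ⟨e'⟩ := nonempty_globalSections_derivedPushforward_iso (S.inclX 1) (sheafInDegreeZero G)
  -- RΓ keeps the cone in degrees ≥ m, so hypercohomology is compared directly.
  have := (hF.rightDerivedFunctorPlus_map (globalSections R X)).isIso_homology j (by lia)
  exact ⟨@asIso _ _ _ _ _ this ≪≫
    (DerivedCategory.Plus.homologyFunctor (ModuleCat.{u} R) j).mapIso e'⟩
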